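/- All graphs are finite, undirected, without loops or parallel edges. A $\Lambda$-factor of a graph $H$ is a spanning subgraph of $H$ each of whose components is a 3-vertex path. A claw is a graph isomorphic to $K_{1,3}$, and a graph is claw-free if it has no induced claw. A $\Delta$-graph is a cubic graph in which every vertex belongs to exactly one triangle. For a set $E$ of edges of $G$, $\dot E$ denotes the subgraph of $G$ induced by $E$ (the edges of $E$ together with their ends), and $G-E$ is obtained from $G$ by deleting the edges in $E$, keeping all vertices. 1. Let $G$ be a 2-connected $\Delta$-graph and let $E\subseteq E(G)$ with $|E|=3$. Then $G-E$ has no $\Lambda$-factor if and only if one of the following holds: (e1) $\dot E$ is a claw; (e2) $\dot E$ is a triangle; (e3) $\dot E$ has exactly two components, a component $\dot E_2$ with two edges and a component $\dot E_1$ with one edge; $\dot E_2$ is contained in a triangle of $G$, $\dot E_1$ is contained in no triangle of $G$, and $G-E$ is not connected; (e4) $\dot E$ has exactly two components, a component $\dot E_2$ with two edges and a component $\dot E_1$ with one edge; $\dot E_2$ is contained in a triangle $T$ of $G$, $\dot E_1$ is contained in a triangle $D$ of $G$, and $\dot E_1$ and $\dot E_2$ are contained in different components of $G-\{d,t\}$,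 where $d$ is the edge of $G$ not in $E(D)\cup E(T)$ incident to the vertex of $D$ not in $\dot E_1$, and $t$ is the edge of $G$ not in $E(D)\cup E(T)$ incident to the isolated vertex of $T-E(\dot E_2)$ (possibly $d=t$). 2. Let $G$ be a 2-connected $\Delta$-graph and let $E\subseteq E(G)$ with $|E|=2$. Then $G-E$ has a $\Lambda$-factor. 3. Let $G$ be a 3-connected cubic claw-free graph with at least 6 vertices and let $E\subseteq E(G)$ with $|E|=3$. Then $G-E$ has a $\Lambda$-factor if and only if $\dot E$ is neither a claw nor a triangle. -/

import Mathlib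

namespace SimpleGraph

variable {V : Type*}

/-- `G` is `k`-connected: it has more than `k` vertices, and it stays connected after the removal
of any set of fewer than `k` vertices. -/
def IsKConnected [Fintype V] (G : SimpleGraph V) (k : ℕ) : Prop :=
  k < Fintype.card V ∧ ∀ S : Finset V, S.card < k → (G.induce {v | v ∉ S}).Connected

/-- The claw `K_{1,3}`. -/
abbrev clawGraph : SimpleGraph (Fin 1 ⊕ Fin 3) := completeBipartiteGraph (Fin 1) (Fin 3)

/-- `G` has no induced subgraph isomorphic to the claw. -/
def IsClawFree (G : SimpleGraph V) : Prop := IsEmpty (clawGraph ↪g G)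

/-- The subgraph `H` of `G` is a claw. -/
def Subgraph.IsClaw {G : SimpleGraph V} (H : G.Subgraph) : Prop :=
  Nonempty (H.coe ≃g clawGraph)

/-- The subgraph `H` of `G` is a triangle. -/
def Subgraph.IsTriangle {G : SimpleGraph V} (H : G.Subgraph) : Prop :=
  Nonempty (H.coe ≃g completeGraph (Fin 3))

/-- A Δ-graph: a cubic graph in which every vertex belongs to exactly one triangle. -/
def IsDeltaGraph (G : SimpleGraph V) [G.LocallyFinite] : Prop :=
  G.IsRegularOfDegree 3 ∧ ∀ v : V, ∃! T : G.Subgraph, T.IsTriangle ∧ v ∈ T.verts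

/-- `H` has a Λ-factor: a spanning subgraph each of whose components is a 3-vertex path. -/
def HasLambdaFactor (H : SimpleGraph V) : Prop :=
  ∃ P : SimpleGraph V, P ≤ H ∧
    ∀ C : P.ConnectedComponent, Nonempty (C.toSimpleGraph ≃g pathGraph 3)

/-- The subgraph of `G` induced by a set `E` of edges: its edges are those in `E`, its vertices
the ends of these edges. -/
def edgeInduced (G : SimpleGraph V) (E : Set (Sym2 V)) : G.Subgraph where
  verts := {v | ∃ w, G.Adj v w ∧ s(v, w) ∈ E}
  Adj v w := G.Adj v w ∧ s(v, w) ∈ E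
  adj_sub h := h.1
  edge_vert h := ⟨_, h⟩
  symm := ⟨fun _ _ h => ⟨h.1.symm, Sym2.eq_swap ▸ h.2⟩⟩

/-- The components of a subgraph: its maximal connected subgraphs. -/
def Subgraph.components {G : SimpleGraph V} (H : G.Subgraph) : Set G.Subgraph :=
  {K | Maximal (fun K' : G.Subgraph => K' ≤ H ∧ K'.Connected) K}

/-- The subgraph induced by `E` has exactly two components, namely `H₂`, which has two edges, and
`H₁`, which has one edge. -/
def HasTwoComponents (G : SimpleGraph V) (E : Set (Sym2 V)) (H₂ H₁ : G.Subgraph) : Prop :=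
  (G.edgeInduced E).components = {H₂, H₁} ∧ H₂.edgeSet.ncard = 2 ∧ H₁.edgeSet.ncard = 1

/-- The first two-component configuration: the 2-edge component of the subgraph induced by `E`
lies in a triangle of `G`, the 1-edge component lies in no triangle of `G`, and `G - E` is not
connected. -/
def ConfigE3 (G : SimpleGraph V) (E : Set (Sym2 V)) : Prop :=
  ∃ H₂ H₁ : G.Subgraph, G.HasTwoComponents E H₂ H₁ ∧
    (∃ T : G.Subgraph, T.IsTriangle ∧ H₂ ≤ T) ∧
    (¬ ∃ D : G.Subgraph, D.IsTriangle ∧ H₁ ≤ D) ∧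
    ¬ (G.deleteEdges E).Connected

/-- The second two-component configuration: the 2-edge component `H₂` of the subgraph induced by
`E` lies in a triangle `T`, the 1-edge component `H₁` lies in a triangle `D`, and `H₁`, `H₂` lie in
different components of `G - {d, t}`. Here `d` and `t` are the edges of `G` outside `D` and `T`
that are incident to the vertex `d₁` of `D` not in `H₁` and to the isolated vertex `t₁` of
`T - E(H₂)`, respectively (`d = t` is possible). -/
def ConfigE4 (G : SimpleGraph V) (E : Set (Sym2 V)) : Prop :=
  ∃ H₂ H₁ T D : G.Subgraph, G.HasTwoComponents E H₂ H₁ ∧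
    T.IsTriangle ∧ H₂ ≤ T ∧ D.IsTriangle ∧ H₁ ≤ D ∧
    ∃ (d₁ t₁ : V) (d t : Sym2 V),
      (d₁ ∈ D.verts ∧ d₁ ∉ H₁.verts) ∧
      (t₁ ∈ T.verts ∧ ∀ w, ¬ (T.deleteEdges H₂.edgeSet).Adj t₁ w) ∧
      (d ∈ G.edgeSet \ (D.edgeSet ∪ T.edgeSet) ∧ d₁ ∈ d) ∧
      (t ∈ G.edgeSet \ (D.edgeSet ∪ T.edgeSet) ∧ t₁ ∈ t) ∧
      ∃ C₁ C₂ : (G.deleteEdges {d, t}).ConnectedComponent,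
        C₁ ≠ C₂ ∧ H₁.verts ⊆ C₁.supp ∧ H₂.verts ⊆ C₂.supp

end SimpleGraph

/-! A Λ-factor is the same thing as a centre map, sending each vertex to the middle of its path. In
a Δ-graph the vertices split into triangles (the fibres of `q`) and the remaining edges form a
perfect matching (the involution `m`).

Rigidity: two centres cannot share a triangle, since the third vertex would be a leaf of both;
counting then puts exactly one centre in every triangle (`center_unique`, `exists_center`). Hence
for a union `S` of triangles, a path with a leaf in `S` and its centre outside is balanced by one
with a leaf outside and its centre in `S` (`exists_center_entering`).

Construction: conversely, take disjoint directed cycles of triangles running along matching edges. A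
visited triangle with entry `i`, exit `o` and third vertex `y` carries the path `m o`, `o`, `y`,
while `i` is a leaf of the path of the previous triangle. An unvisited triangle carries a path on
its own three vertices (`hasLambdaFactor_of_isExitSet`). With no cycle at all this gives a factor of
`G - E` unless two edges `xz`, `yz` of one triangle are deleted. In that case a cycle entering this
triangle at `z` is sought. Either it exists, or the triangles reachable from that of `z` form a set
`U` whose only exits are `z` and forbidden vertices (`hasLambdaFactor_or_exists_cut`).

By 2-connectivity `U` has an exit other than `z`. With two deleted edges nothing is forbidden, so a
factor exists. With three, the position of the third edge decides: at `z` it completes a claw, at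
`xy` a triangle, and on the matching edge of `x` or `y` it leaves a factor. On a disjoint matching
edge, or in another triangle, the cut is the third or fourth configuration. Conversely, `z` has
become a leaf attached to `m z`, and the balance argument excludes a factor in those two
configurations.

For 3-connected graphs, claw-freeness gives each vertex a triangle, a diamond would yield a 2-vertex
cut, and neither two-component configuration can occur. -/

namespace SimpleGraph

variable {V : Type*} {G : SimpleGraph V}

/-! ### Λ-factors as centre maps -/

/-- A map sending each vertex to the middle vertex of its path in a Λ-factor of `H`. -/
structure IsCenterMap (H : SimpleGraph V) (c : V → V) : Prop where
  idem : ∀ v, c (c v) = c v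
  adj : ∀ v, v ≠ c v → H.Adj v (c v)
  card : ∀ v, {w | c w = c v}.ncard = 3

/-- The forest of stars joining each vertex to its centre. -/
def starForest (c : V → V) : SimpleGraph V where
  Adj v w := v ≠ w ∧ (w = c v ∨ v = c w)
  symm := ⟨fun _ _ h => ⟨h.1.symm, h.2.symm⟩⟩
  loopless := ⟨fun _ h => h.1 rfl⟩

theorem starForest_reachable_center (c : V → V) (v : V) : (starForest c).Reachable v (c v) := by
  by_cases h : v = c v
  · rw [← h]
  · exact Adj.reachable (show (starForest c).Adj v (c v) from ⟨h, Or.inl rfl⟩)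

theorem starForest_reachable_iff {c : V → V} (hc : ∀ v, c (c v) = c v) (v w : V) :
    (starForest c).Reachable v w ↔ c v = c w := by
  constructor
  · rintro ⟨p⟩
    induction p with
    | nil => rfl
    | cons h p ih =>
      rw [← ih]
      rcases h.2 with h | h
      · rw [h, hc]
      · rw [h, hc]
  · intro h
    have h1 := starForest_reachable_center c v
    rw [h] at h1
    exact h1.trans (starForest_reachable_center c w).symm

/-- The components of the star forest are the fibres of `c`, and a three-element fibre consists of
its centre `b` and two leaves joined only to `b`. -/
theorem hasLambdaFactor_of_isCenterMap {H : SimpleGraph V} {c : V → V} (hc : H.IsCenterMap c) :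
    H.HasLambdaFactor := by
  refine ⟨starForest c, ?_, ?_⟩
  · rintro v w ⟨hne, h | h⟩
    · subst h; exact hc.adj v hne
    · subst h; exact (hc.adj w hne.symm).symm
  · intro C
    induction C using ConnectedComponent.ind with
    | _ v =>
    obtain ⟨b, hb⟩ : ∃ b, b = c v := ⟨_, rfl⟩
    have hcb : c b = b := by rw [hb, hc.idem]
    have hcard := hc.card v
    rw [← hb] at hcard
    have hmem : b ∈ {w | c w = b} := hcb
    have hfin : {w | c w = b}.Finite := Set.finite_of_ncard_pos (by omega)
    have h2 : ({w | c w = b} \ {b}).ncard = 2 := by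
      rw [Set.ncard_sdiff_singleton_of_mem hmem, hcard]
    obtain ⟨x, y, hxy, hset⟩ := Set.ncard_eq_two.1 h2
    have hx : x ∈ {w | c w = b} \ {b} := hset ▸ Or.inl rfl
    have hy : y ∈ {w | c w = b} \ {b} := hset ▸ Or.inr rfl
    have hxb : x ≠ b := hx.2
    have hyb : y ≠ b := hy.2
    have hcx : c x = b := hx.1
    have hcy : c y = b := hy.1
    have hsupp : ∀ w, w ∈ ((starForest c).connectedComponentMk v).supp ↔ c w = b := by
      intro w
      rw [ConnectedComponent.mem_supp_iff, ConnectedComponent.eq,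
        starForest_reachable_iff hc.idem, hb]
    have hall : ∀ w, c w = b → w = x ∨ w = b ∨ w = y := by
      intro w hw
      by_cases hwb : w = b
      · exact Or.inr (Or.inl hwb)
      · have : w ∈ ({x, y} : Set V) := hset ▸ ⟨hw, hwb⟩
        rcases this with h | h
        · exact Or.inl h
        · exact Or.inr (Or.inr h)
    let f : Fin 3 → ((starForest c).connectedComponentMk v).supp :=
      ![⟨x, (hsupp x).2 hcx⟩, ⟨b, (hsupp b).2 hcb⟩, ⟨y, (hsupp y).2 hcy⟩]
    have hf : Function.Bijective f := by
      constructor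
      · intro i j hij
        have hij' : (f i).1 = (f j).1 := congrArg Subtype.val hij
        fin_cases i <;> fin_cases j <;>
          first
          | rfl
          | exact absurd hij' hxb
          | exact absurd hij' hxy
          | exact absurd hij' hyb
          | exact absurd hij'.symm hxb
          | exact absurd hij'.symm hxy
          | exact absurd hij'.symm hyb
      · rintro ⟨w, hw⟩
        rcases hall w ((hsupp w).1 hw) with rfl | rfl | rfl
        · exact ⟨0, rfl⟩
        · exact ⟨1, rfl⟩
        · exact ⟨2, rfl⟩
    refine ⟨RelIso.symm ⟨Equiv.ofBijective f hf, ?_⟩⟩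
    intro i j
    change (starForest c).Adj (f i).1 (f j).1 ↔ _
    have hb1 : b ≠ x := hxb.symm
    have hb2 : b ≠ y := hyb.symm
    fin_cases i <;> fin_cases j <;>
      simp [f, starForest, pathGraph_adj, hcx, hcy, hcb, hxb, hyb, hxy, hb1, hb2]

theorem exists_isCenterMap_of_hasLambdaFactor {H : SimpleGraph V} (h : H.HasLambdaFactor) :
    ∃ c, H.IsCenterMap c := by
  obtain ⟨P, hP, hC⟩ := h
  let φ : ∀ C : P.ConnectedComponent, C.toSimpleGraph ≃g pathGraph 3 := fun C => (hC C).some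
  have hmk : ∀ C : P.ConnectedComponent, ∀ i, P.connectedComponentMk ((φ C).symm i).1 = C :=
    fun C i => ((φ C).symm i).2
  -- Index 1 is the middle vertex of `pathGraph 3`.
  let c : V → V := fun v => ((φ (P.connectedComponentMk v)).symm 1).1
  have hcc : ∀ v, P.connectedComponentMk (c v) = P.connectedComponentMk v := fun v => hmk _ 1
  have hc_iff : ∀ v w, c w = c v ↔ P.connectedComponentMk w = P.connectedComponentMk v := by
    intro v w
    constructor
    · intro h
      rw [← hcc w, h, hcc v]
    · intro h
      exact congrArg (fun C => ((φ C).symm 1).1) h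
  refine ⟨c, ⟨fun v => (hc_iff _ _).2 (hcc v), ?_, ?_⟩⟩
  · intro v hv
    apply hP
    set C := P.connectedComponentMk v with hCdef
    have hvC : v ∈ C.supp := rfl
    obtain ⟨i, hi⟩ := (φ C).symm.surjective ⟨v, hvC⟩
    have hvi : v = ((φ C).symm i).1 := by rw [hi]
    have : (pathGraph 3).Adj i 1 := by
      have h1 : i ≠ 1 := by
        rintro rfl
        exact hv hvi
      rw [pathGraph_adj]
      fin_cases i <;> simp_all
    have h2 := (φ C).symm.map_rel_iff.2 this
    have h3 : P.Adj ((φ C).symm i).1 ((φ C).symm 1).1 := h2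
    rw [← hvi] at h3
    exact h3
  · intro v
    have : {w | c w = c v} = (P.connectedComponentMk v).supp := by
      ext w
      exact hc_iff v w
    rw [this, ← Nat.card_coe_set_eq]
    exact (Nat.card_congr (φ (P.connectedComponentMk v)).toEquiv).trans (by simp)

theorem hasLambdaFactor_iff {H : SimpleGraph V} : H.HasLambdaFactor ↔ ∃ c, H.IsCenterMap c :=
  ⟨exists_isCenterMap_of_hasLambdaFactor, fun ⟨_, h⟩ => hasLambdaFactor_of_isCenterMap h⟩

theorem IsCenterMap.exists_two_adj {H : SimpleGraph V} {c : V → V} (hc : H.IsCenterMap c)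
    {b : V} (hb : c b = b) :
    ∃ u w, u ≠ w ∧ u ≠ b ∧ w ≠ b ∧ H.Adj u b ∧ H.Adj w b ∧ c u = b ∧ c w = b := by
  have hcard := hc.card b
  rw [hb] at hcard
  have h2 : ({w | c w = b} \ {b}).ncard = 2 := by
    rw [Set.ncard_sdiff_singleton_of_mem (show b ∈ {w | c w = b} from hb), hcard]
  obtain ⟨x, y, hxy, hset⟩ := Set.ncard_eq_two.1 h2
  have hx : x ∈ {w | c w = b} \ {b} := hset ▸ Or.inl rfl
  have hy : y ∈ {w | c w = b} \ {b} := hset ▸ Or.inr rfl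
  have hcx : c x = b := hx.1
  have hcy : c y = b := hy.1
  have hxb : x ≠ b := hx.2
  have hyb : y ≠ b := hy.2
  refine ⟨x, y, hxy, hxb, hyb, ?_, ?_, hcx, hcy⟩
  · have := hc.adj x (by rw [hcx]; exact hxb)
    rwa [hcx] at this
  · have := hc.adj y (by rw [hcy]; exact hyb)
    rwa [hcy] at this

-- The double count behind the balance arguments: it is applied both to centre maps, with fibres the
-- paths, and to the partition into triangles.
open Classical in
theorem card_filter_mem_of_fibers {α β : Type*} [Fintype α] (f : α → β) (B : Finset β) {k : ℕ}
    (hf : ∀ b ∈ B, {a | f a = b}.ncard = k) :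
    (Finset.univ.filter fun a => f a ∈ B).card = B.card * k := by
  rw [Finset.card_eq_sum_card_fiberwise (f := f) (t := B)]
  · rw [Finset.sum_const_nat]
    intro b hb
    rw [← hf b hb, ← Set.ncard_coe_finset]
    congr 1
    ext a
    simp only [Finset.coe_filter, Finset.mem_filter, Finset.mem_univ, true_and, Set.mem_ofPred_eq]
    exact ⟨fun h => h.2, fun h => ⟨h ▸ hb, h⟩⟩
  · intro a ha
    simpa using ha

/-! ### Partitions into triangles joined by a perfect matching -/

/-- The vertices of `G` are partitioned into triangles, the fibres of `q`, and the remaining edges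
of `G` form a perfect matching, given by the involution `m`. -/
structure TriangleStructure {Q : Type*} (G : SimpleGraph V) (q : V → Q) (m : V → V) : Prop where
  adj_iff : ∀ v w, G.Adj v w ↔ (v ≠ w ∧ q v = q w) ∨ w = m v
  inv : ∀ v, m (m v) = v
  ne : ∀ v, q (m v) ≠ q v
  card : ∀ v, {w | q w = q v}.ncard = 3

namespace TriangleStructure

variable {Q : Type*} {q : V → Q} {m : V → V}

theorem exists_others (h : G.TriangleStructure q m) (z : V) :
    ∃ x y, x ≠ y ∧ x ≠ z ∧ y ≠ z ∧ q x = q z ∧ q y = q z := by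
  have h2 : ({w | q w = q z} \ {z}).ncard = 2 := by
    rw [Set.ncard_sdiff_singleton_of_mem (show z ∈ {w | q w = q z} from rfl), h.card]
  obtain ⟨x, y, hxy, hset⟩ := Set.ncard_eq_two.1 h2
  have hx : x ∈ {w | q w = q z} \ {z} := hset ▸ Or.inl rfl
  have hy : y ∈ {w | q w = q z} \ {z} := hset ▸ Or.inr rfl
  exact ⟨x, y, hxy, hx.2, hy.2, hx.1, hy.1⟩

theorem class_eq (h : G.TriangleStructure q m) {x y z : V} (hxy : x ≠ y) (hxz : x ≠ z)
    (hyz : y ≠ z) (hx : q x = q z) (hy : q y = q z) : {w | q w = q z} = {x, y, z} := by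
  have hfin : {w | q w = q z}.Finite := Set.finite_of_ncard_pos (by rw [h.card]; omega)
  symm
  apply Set.eq_of_subset_of_ncard_le _ _ hfin
  · rintro w (rfl | rfl | rfl)
    · exact hx
    · exact hy
    · rfl
  · rw [h.card, Set.ncard_eq_three.2 ⟨x, y, z, hxy, hxz, hyz, rfl⟩]

theorem eq_of_class (h : G.TriangleStructure q m) {x y z w : V} (hxy : x ≠ y) (hxz : x ≠ z)
    (hyz : y ≠ z) (hx : q x = q z) (hy : q y = q z) (hw : q w = q z) : w = x ∨ w = y ∨ w = z := by
  have : w ∈ {w | q w = q z} := hw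
  rw [h.class_eq hxy hxz hyz hx hy] at this
  simpa using this

theorem exists_third (h : G.TriangleStructure q m) (x y : V) :
    ∃ z, z ≠ x ∧ z ≠ y ∧ q z = q y := by
  obtain ⟨u, w, huw, huy, hwy, hu, hw⟩ := h.exists_others y
  by_cases hux : u = x
  · exact ⟨w, fun h => huw (hux.trans h.symm), hwy, hw⟩
  · exact ⟨u, hux, huy, hu⟩

theorem m_ne (h : G.TriangleStructure q m) (v : V) : m v ≠ v := fun e => h.ne v (by rw [e])

theorem m_inj (h : G.TriangleStructure q m) {v w : V} (e : m v = m w) : v = w := by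
  rw [← h.inv v, e, h.inv]

theorem adj_m (h : G.TriangleStructure q m) (v : V) : G.Adj v (m v) :=
  (h.adj_iff _ _).2 (Or.inr rfl)

theorem adj_of_q (h : G.TriangleStructure q m) {v w : V} (hne : v ≠ w) (hq : q v = q w) :
    G.Adj v w := (h.adj_iff _ _).2 (Or.inl ⟨hne, hq⟩)

/-! ### Each triangle contains exactly one centre -/

section Centers

variable {H : SimpleGraph V} {c : V → V}

/-- A centre `b` has two leaves, at most one of which is `m b`. The other lies in its triangle and
is not the centre `b'`, so it is the third vertex `y`. By symmetry `y` is also a leaf of `b'`. -/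
theorem center_unique (h : G.TriangleStructure q m) (hH : H ≤ G) (hc : H.IsCenterMap c)
    {b b' : V} (hb : c b = b) (hb' : c b' = b') (hq : q b = q b') : b = b' := by
  by_contra hne
  obtain ⟨y, hyb, hyb', hy⟩ := h.exists_third b b'
  have key : ∀ {b b' : V}, c b = b → c b' = b' → q b = q b' → b ≠ b' → y ≠ b → y ≠ b' →
      q y = q b' → c y = b := by
    intro b b' hb hb' hqb hne hyb hyb' hy
    obtain ⟨u, w, huw, hub, hwb, hu, hw, hcu, hcw⟩ := hc.exists_two_adj hb
    have aux : ∀ u, u ≠ b → H.Adj u b → c u = b → u ≠ m b → u = y := by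
      intro u hub hu hcu hum
      rcases (h.adj_iff _ _).1 (hH hu) with ⟨-, h1⟩ | h1
      · rcases h.eq_of_class hne hyb.symm hyb'.symm (hqb.trans hy.symm) hy.symm
          (h1.trans (hqb.trans hy.symm)) with h2 | h2 | h2
        · exact absurd h2 hub
        · subst h2; exact absurd (hcu.symm.trans hb') hne
        · exact h2
      · exact absurd (by rw [h1, h.inv]) hum
    by_cases hum : u = m b
    · have : w = y := aux w hwb hw hcw (fun e => huw (hum.trans e.symm))
      rw [← this, hcw]
    · rw [← aux u hub hu hcu hum, hcu]
  exact hne ((key hb hb' hq hne hyb hyb' hy).symm.trans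
    (key hb' hb hq.symm (Ne.symm hne) hyb' hyb (hy.trans hq.symm)))

-- Paths and triangles both partition the vertices into triples, so there are as many centres as
-- triangles; by `center_unique` the map from centres to triangles is injective, hence onto.
open Classical in
theorem exists_center [Fintype V] (h : G.TriangleStructure q m) (hH : H ≤ G)
    (hc : H.IsCenterMap c) (v : V) : ∃ b, q b = q v ∧ c b = b := by
  let B : Finset V := Finset.univ.filter fun b => c b = b
  have hB : ∀ b, b ∈ B ↔ c b = b := fun b => by simp [B]
  have h1 := card_filter_mem_of_fibers c B (k := 3) (by
    intro b hb
    have := hc.card b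
    rwa [(hB b).1 hb] at this)
  have h2 := card_filter_mem_of_fibers q (Finset.univ.image q) (k := 3) (by
    intro s hs
    obtain ⟨v, -, rfl⟩ := Finset.mem_image.1 hs
    exact h.card v)
  rw [Finset.filter_true_of_mem (fun v _ => (hB _).2 (hc.idem v))] at h1
  rw [Finset.filter_true_of_mem (fun v _ => Finset.mem_image_of_mem q (Finset.mem_univ v))] at h2
  have h3 : B.image q = Finset.univ.image q := by
    apply Finset.eq_of_subset_of_card_le (Finset.image_subset_image (Finset.subset_univ _))
    rw [Finset.card_image_of_injOn (s := B)]
    · omega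
    · intro b hb b' hb' hq
      exact h.center_unique hH hc ((hB b).1 hb) ((hB b').1 hb') hq
  have h4 : q v ∈ B.image q := h3 ▸ Finset.mem_image_of_mem q (Finset.mem_univ v)
  obtain ⟨b, hb, hq⟩ := Finset.mem_image.1 h4
  exact ⟨b, hq, (hB b).1 hb⟩

open Classical in
/-- A path of a Λ-factor that leaves a union of triangles is balanced by one that enters it. -/
theorem exists_center_entering [Fintype V] (h : G.TriangleStructure q m) (hH : H ≤ G)
    (hc : H.IsCenterMap c) {S : Set V} (hS : ∀ v w, q v = q w → v ∈ S → w ∈ S)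
    {v : V} (hv : v ∈ S) (hcv : c v ∉ S) : ∃ w, w ∉ S ∧ c w ∈ S := by
  by_contra! hcon
  choose k hkq hkc using h.exists_center hH hc
  have hk : ∀ v w, k v = k w ↔ q v = q w := by
    intro v w
    constructor
    · intro e
      rw [← hkq v, e, hkq]
    · intro e
      exact h.center_unique hH hc (hkc v) (hkc w) (by rw [hkq, hkq, e])
  -- Three times the number of centres in `S` counts both the vertices whose path has its centre in
  -- `S` and the vertices of `S` itself. If no path enters `S`, the first set is contained in the
  -- second and misses `v`.
  let B : Finset V := Finset.univ.filter fun b => c b = b ∧ b ∈ S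
  have hB : ∀ b, b ∈ B ↔ c b = b ∧ b ∈ S := fun b => by simp [B]
  have h1 := card_filter_mem_of_fibers c B (k := 3) (by
    intro b hb
    have := hc.card b
    rwa [((hB b).1 hb).1] at this)
  have h2 := card_filter_mem_of_fibers k B (k := 3) (by
    intro b hb
    have h3 : k b = b := h.center_unique hH hc (hkc b) ((hB b).1 hb).1 (hkq b)
    have h4 : {w | k w = b} = {w | q w = q b} := by
      ext w
      rw [Set.mem_ofPred_eq, Set.mem_ofPred_eq, ← hk, h3]
    rw [h4]
    exact h.card b)
  rw [← h1] at h2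
  refine absurd h2 (ne_of_gt (Finset.card_lt_card ?_))
  rw [Finset.ssubset_iff_of_subset]
  · refine ⟨v, ?_, ?_⟩
    · simp only [Finset.mem_filter, Finset.mem_univ, true_and, hB]
      exact ⟨hkc v, hS _ _ (hkq v).symm hv⟩
    · simp only [Finset.mem_filter, Finset.mem_univ, true_and, hB]
      exact fun h => hcv h.2
  · intro w
    simp only [Finset.mem_filter, Finset.mem_univ, true_and, hB]
    rintro ⟨-, hw⟩
    have hwS : w ∈ S := by
      by_contra hwS
      exact hcon w hwS hw
    exact ⟨hkc w, hS _ _ (hkq w).symm hwS⟩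

end Centers

/-! ### Factors from directed cycles of triangles -/

/-- The set of vertices by which a family of disjoint directed cycles of triangles leaves the
triangles it visits. -/
structure IsExitSet (q : V → Q) (m : V → V) (O : Set V) : Prop where
  exit_inj : ∀ o ∈ O, ∀ o' ∈ O, q o = q o' → o = o'
  entry_notMem : ∀ o ∈ O, m o ∉ O
  exists_entry : ∀ o ∈ O, ∃ o' ∈ O, q (m o') = q o
  exists_exit : ∀ o ∈ O, ∃ o' ∈ O, q o' = q (m o)
  entry_inj : ∀ o ∈ O, ∀ o' ∈ O, q (m o) = q (m o') → o = o'

theorem isExitSet_empty (q : V → Q) (m : V → V) : IsExitSet q m ∅ := by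
  constructor <;> simp

open Classical in
/-- A family of disjoint directed cycles of triangles that suitably avoids `E` gives a Λ-factor of
`G - E`. -/
theorem hasLambdaFactor_of_isExitSet (h : G.TriangleStructure q m) {O : Set V}
    (hO : IsExitSet q m O) {E : Set (Sym2 V)} (hE₁ : ∀ o ∈ O, s(o, m o) ∉ E)
    (hE₂ : ∀ o ∈ O, ∀ y, q y = q o → y ≠ o → m y ∉ O → s(o, y) ∉ E)
    (hE₃ : ∀ v, (∀ o ∈ O, q o ≠ q v) → ∃ b, q b = q v ∧ ∀ y, q y = q v → y ≠ b → s(b, y) ∉ E) :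
    (G.deleteEdges E).HasLambdaFactor := by
  -- One centre is chosen per triangle: the exit if the triangle is visited, otherwise the vertex
  -- supplied by `hE₃`. Labels outside the range of `q` get the dummy `id`.
  have hK : ∀ s : Q, ∃ k : V → V, ∀ v, q v = s → q (k v) = s ∧ (k v ∈ O ∨
      ((∀ o ∈ O, q o ≠ s) ∧ ∀ y, q y = s → y ≠ k v → s(k v, y) ∉ E)) ∧ ∀ w, q w = s → k v = k w := by
    intro s
    by_cases hs : ∃ v, q v = s
    · obtain ⟨v, rfl⟩ := hs
      by_cases ho : ∃ o ∈ O, q o = q v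
      · obtain ⟨o, hoO, hov⟩ := ho
        exact ⟨fun _ => o, fun _ _ => ⟨hov, Or.inl hoO, fun _ _ => rfl⟩⟩
      · push Not at ho
        obtain ⟨b, hb, hbE⟩ := hE₃ v ho
        exact ⟨fun _ => b, fun _ _ => ⟨hb, Or.inr ⟨ho, hbE⟩, fun _ _ => rfl⟩⟩
    · exact ⟨id, fun v hv => absurd ⟨v, hv⟩ hs⟩
  choose K hK using hK
  obtain ⟨k, hk⟩ : ∃ k : V → V, k = fun v => K (q v) v := ⟨_, rfl⟩
  have hkq : ∀ v, q (k v) = q v := fun v => hk ▸ (hK (q v) v rfl).1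
  have hkc : ∀ v w, q v = q w → k v = k w := by
    intro v w e
    rw [hk]
    simpa only [e] using (hK (q v) v rfl).2.2 w e.symm
  have hkO : ∀ v, k v ∈ O ∨ ((∀ o ∈ O, q o ≠ q v) ∧ ∀ y, q y = q v → y ≠ k v → s(k v, y) ∉ E) :=
    fun v => hk ▸ (hK (q v) v rfl).2.1
  clear hk hK
  have hko : ∀ o ∈ O, ∀ v, q v = q o → k v = o := by
    intro o ho v hv
    rcases hkO v with h1 | ⟨h1, -⟩
    · exact hO.exit_inj _ h1 _ ho ((hkq v).trans hv)
    · exact absurd hv.symm (h1 o ho)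
  -- An entry vertex `v = m o` is attached to the exit `o` of the preceding triangle, every other
  -- vertex to the centre of its own triangle.
  refine hasLambdaFactor_of_isCenterMap (c := fun v => if m v ∈ O then m v else k v) ⟨?_, ?_, ?_⟩
  · intro v
    by_cases hv : m v ∈ O
    · rw [if_pos hv, if_neg (hO.entry_notMem _ hv), hko _ hv _ rfl]
    · rw [if_neg hv]
      have h1 : m (k v) ∉ O := by
        intro h1
        obtain ⟨o, ho, h2⟩ := hO.exists_exit _ h1
        rw [h.inv, hkq] at h2
        rw [hko o ho v h2.symm] at h1
        exact hO.entry_notMem o ho h1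
      rw [if_neg h1, hkc _ _ (hkq v)]
  · intro v hv
    rw [deleteEdges_adj]
    by_cases hmv : m v ∈ O
    · rw [if_pos hmv]
      refine ⟨h.adj_m v, ?_⟩
      have := hE₁ _ hmv
      rwa [h.inv, Sym2.eq_swap] at this
    · rw [if_neg hmv] at hv ⊢
      refine ⟨h.adj_of_q hv (hkq v).symm, ?_⟩
      rw [Sym2.eq_swap]
      rcases hkO v with h1 | ⟨-, h1⟩
      · exact hE₂ _ h1 v (hkq v).symm hv hmv
      · exact h1 v rfl hv
  · intro v
    have hkv : ∃ b, (if m v ∈ O then m v else k v) = b ∧ (b ∈ O ∨ (k b = b ∧ ∀ o ∈ O, q o ≠ q b)) := by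
      by_cases hv : m v ∈ O
      · exact ⟨m v, if_pos hv, Or.inl hv⟩
      · refine ⟨k v, if_neg hv, ?_⟩
        rw [hkc _ _ (hkq v), hkq]
        rcases hkO v with h1 | ⟨h1, -⟩
        · exact Or.inl h1
        · exact Or.inr ⟨rfl, h1⟩
    obtain ⟨b, hb, hbO⟩ := hkv
    rw [hb]
    clear hb v
    rcases hbO with hbO | ⟨hkb, hbO⟩
    -- The fibre of an exit `b` is `m b`, `b` and the vertex `y` of the triangle that is neither
    -- entry nor exit; by `entry_inj` there is no second entry.
    · obtain ⟨o', ho', hq'⟩ := hO.exists_entry b hbO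
      obtain ⟨y, hyi, hyb, hy⟩ := h.exists_third (m o') b
      have hib : m o' ≠ b := fun e => hO.entry_notMem o' ho' (e ▸ hbO)
      have hmy : m y ∉ O := fun h1 => hyi (by
        rw [← hO.entry_inj _ h1 _ ho' (by rw [h.inv, hy, hq']), h.inv])
      refine Set.ncard_eq_three.2 ⟨m b, b, y, h.m_ne b, fun e => h.ne b (by rw [e, hy]), hyb.symm, ?_⟩
      ext w
      simp only [Set.mem_ofPred_eq, Set.mem_insert_iff, Set.mem_singleton_iff]
      constructor
      · intro hw
        by_cases hmw : m w ∈ O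
        · rw [if_pos hmw] at hw
          exact Or.inl (by rw [← hw, h.inv])
        · rw [if_neg hmw] at hw
          have hqw : q w = q b := by rw [← hw, hkq]
          rcases h.eq_of_class hyi.symm hib hyb hq' hy hqw with h1 | h1 | h1
          · rw [h1, h.inv] at hmw
            exact absurd ho' hmw
          · exact Or.inr (Or.inr h1)
          · exact Or.inr (Or.inl h1)
      · rintro (rfl | rfl | rfl)
        · rw [h.inv, if_pos hbO]
        · rw [if_neg (hO.entry_notMem _ hbO), hko _ hbO _ rfl]
        · rw [if_neg hmy, hko _ hbO _ hy]
    · rw [← h.card b]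
      congr 1
      ext w
      simp only [Set.mem_ofPred_eq]
      constructor
      · intro hw
        by_cases hmw : m w ∈ O
        · rw [if_pos hmw] at hw
          exact absurd rfl (hbO b (hw ▸ hmw))
        · rw [if_neg hmw] at hw
          rw [← hw, hkq]
      · intro hw
        have hmw : m w ∉ O := by
          intro h1
          obtain ⟨o, ho, h2⟩ := hO.exists_exit _ h1
          rw [h.inv, hw] at h2
          exact hbO o ho h2
        rw [if_neg hmw, hkc _ _ hw, hkb]

/-- A chain of minimal length cannot repeat a value. -/
theorem exists_injective_chain {R : Q → Q → Prop} {s s' : Q} (h : Relation.ReflTransGen R s s') :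
    ∃ (n : ℕ) (τ : ℕ → Q), τ 0 = s ∧ τ n = s' ∧ (∀ i < n, R (τ i) (τ (i + 1))) ∧
      ∀ i ≤ n, ∀ j ≤ n, τ i = τ j → i = j := by
  classical
  have hex : ∃ n, ∃ τ : ℕ → Q, τ 0 = s ∧ τ n = s' ∧ ∀ i < n, R (τ i) (τ (i + 1)) := by
    induction h with
    | refl => exact ⟨0, fun _ => s, rfl, rfl, by simp⟩
    | @tail b c _ hbc ih =>
      obtain ⟨n, τ, h0, hn, hR⟩ := ih
      refine ⟨n + 1, fun i => if i ≤ n then τ i else c, by simpa using h0, by simp, ?_⟩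
      intro i hi
      rcases Nat.lt_succ_iff_lt_or_eq.1 hi with hi | rfl
      · have h1 : i ≤ n := hi.le
        have h2 : i + 1 ≤ n := hi
        simpa [h1, h2] using hR i hi
      · simpa [hn] using hbc
  obtain ⟨τ, h0, hn, hR⟩ := Nat.find_spec hex
  refine ⟨Nat.find hex, τ, h0, hn, hR, ?_⟩
  have key : ∀ i j, i < j → j ≤ Nat.find hex → τ i ≠ τ j := by
    intro i j hij hj e
    -- A repetition at `i < j` allows the stretch between them to be cut out, shortening the chain
    -- by `j - i`.
    refine Nat.find_min hex (m := Nat.find hex - (j - i)) (by omega)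
      ⟨fun k => if k ≤ i then τ k else τ (k + (j - i)), by simpa using h0, ?_, ?_⟩
    · by_cases h1 : Nat.find hex - (j - i) ≤ i
      · have h2 : Nat.find hex - (j - i) = i := by omega
        have h3 : j = Nat.find hex := by omega
        simp only [h2, le_refl, if_true]
        rw [e, h3, hn]
      · simp only [h1, if_false]
        rw [Nat.sub_add_cancel (by omega), hn]
    · intro k hk
      by_cases h1 : k + 1 ≤ i
      · have h2 : k ≤ i := by omega
        simpa only [h1, h2, if_true] using hR k (by omega)
      · by_cases h2 : k ≤ i
        · have h3 : k = i := by omega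
          subst h3
          simp only [le_refl, if_true, h1, if_false]
          rw [e, show k + 1 + (j - k) = j + 1 by omega]
          exact hR j (by omega)
        · simp only [h1, h2, if_false]
          rw [show k + 1 + (j - i) = k + (j - i) + 1 by omega]
          exact hR _ (by omega)
  intro i hi j hj e
  rcases lt_trichotomy i j with hlt | heq | hgt
  · exact absurd e (key i j hlt hj)
  · exact heq
  · exact absurd e.symm (key j i hgt hi)

/-- The triangle `s'` can be entered from `s` without using an arc that starts in `F` or lies on
the edge between `z` and `m z`. -/
def Step (q : V → Q) (m : V → V) (z : V) (F : Set V) (s s' : Q) : Prop :=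
  ∃ v, q v = s ∧ q (m v) = s' ∧ v ≠ z ∧ v ≠ m z ∧ v ∉ F

/-- An injective chain of triangles from that of `z` to that of `m z` is closed into a directed
cycle by the arc from `m z` to `z`. -/
theorem exists_isExitSet (h : G.TriangleStructure q m) {z : V} {F : Set V}
    (hz : Relation.ReflTransGen (Step q m z F) (q z) (q (m z))) :
    ∃ O, IsExitSet q m O ∧ m z ∈ O ∧ ∀ o ∈ O, o = m z ∨ (o ≠ z ∧ o ∉ F) := by
  classical
  obtain ⟨n, τ, h0, hn, hR, hinj⟩ := exists_injective_chain hz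
  have hn0 : 0 < n := by
    rcases Nat.eq_zero_or_pos n with rfl | h1
    · exact absurd (hn.symm.trans h0) (h.ne z)
    · exact h1
  have hv : ∀ i, ∃ v, i < n → q v = τ i ∧ q (m v) = τ (i + 1) ∧ v ≠ z ∧ v ≠ m z ∧ v ∉ F := by
    intro i
    by_cases hi : i < n
    · obtain ⟨v, hv⟩ := hR i hi
      exact ⟨v, fun _ => hv⟩
    · exact ⟨z, fun hi' => absurd hi' hi⟩
  choose v hv using hv
  have hO : ∀ o, (o = m z ∨ ∃ i < n, v i = o) → ∃ i ≤ n, q o = τ i ∧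
      (i = n ∧ o = m z ∨ i < n ∧ o = v i) := by
    rintro o (rfl | ⟨i, hi, rfl⟩)
    · exact ⟨n, le_rfl, hn.symm, Or.inl ⟨rfl, rfl⟩⟩
    · exact ⟨i, hi.le, (hv i hi).1, Or.inr ⟨hi, rfl⟩⟩
  have hex : ∀ i ≤ n, ∃ o, (o = m z ∨ ∃ i < n, v i = o) ∧ q o = τ i := by
    intro i hi
    rcases hi.lt_or_eq with hi | rfl
    · exact ⟨v i, Or.inr ⟨i, hi, rfl⟩, (hv i hi).1⟩
    · exact ⟨m z, Or.inl rfl, hn.symm⟩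
  have hqm : ∀ o, (o = m z ∨ ∃ i < n, v i = o) → ∃ j ≤ n, q (m o) = τ j ∧
      (j = 0 ∧ o = m z ∨ ∃ i < n, j = i + 1 ∧ o = v i) := by
    rintro o (rfl | ⟨i, hi, rfl⟩)
    · exact ⟨0, n.zero_le, by rw [h.inv, h0], Or.inl ⟨rfl, rfl⟩⟩
    · exact ⟨i + 1, hi, (hv i hi).2.1, Or.inr ⟨i, hi, rfl, rfl⟩⟩
  have hexm : ∀ j ≤ n, ∃ o, (o = m z ∨ ∃ i < n, v i = o) ∧ q (m o) = τ j := by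
    intro j hj
    rcases j with _ | i
    · exact ⟨m z, Or.inl rfl, by rw [h.inv, h0]⟩
    · exact ⟨v i, Or.inr ⟨i, hj, rfl⟩, (hv i hj).2.1⟩
  refine ⟨{o | o = m z ∨ ∃ i < n, v i = o}, ⟨?_, ?_, ?_, ?_, ?_⟩, Or.inl rfl, ?_⟩
  · intro o ho o' ho' e
    obtain ⟨i, hi, hqi, hoi⟩ := hO o ho
    obtain ⟨j, hj, hqj, hoj⟩ := hO o' ho'
    have hij : i = j := hinj i hi j hj (by rw [← hqi, ← hqj, e])
    subst hij
    rcases hoi with ⟨h1, h2⟩ | ⟨h1, h2⟩ <;> rcases hoj with ⟨h3, h4⟩ | ⟨h3, h4⟩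
    · rw [h2, h4]
    · omega
    · omega
    · rw [h2, h4]
  · rintro o (rfl | ⟨i, hi, rfl⟩) ho'
    · rw [h.inv] at ho'
      rcases ho' with h1 | ⟨i, hi, h1⟩
      · exact h.m_ne z h1.symm
      · exact (hv i hi).2.2.1 h1
    · rcases ho' with h1 | ⟨j, hj, h1⟩
      · exact (hv i hi).2.2.1 (h.m_inj h1)
      -- If `v j` were the reverse of the arc `v i`, injectivity of the chain would give both `j = i
      -- + 1` and `i = j + 1`.
      · have h2 : j = i + 1 := hinj j hj.le (i + 1) hi (by rw [← (hv j hj).1, h1, (hv i hi).2.1])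
        subst h2
        have h3 : i = i + 1 + 1 := hinj i hi.le _ hj (by
          rw [← (hv i hi).1, ← (hv _ hj).2.1, h1, h.inv])
        omega
  · intro o ho
    obtain ⟨i, hi, hqi, -⟩ := hO o ho
    obtain ⟨o', ho', hq'⟩ := hexm i hi
    exact ⟨o', ho', hq'.trans hqi.symm⟩
  · intro o ho
    obtain ⟨j, hj, hqj, -⟩ := hqm o ho
    obtain ⟨o', ho', hq'⟩ := hex j hj
    exact ⟨o', ho', hq'.trans hqj.symm⟩
  · intro o ho o' ho' e
    obtain ⟨i, hi, hqi, hoi⟩ := hqm o ho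
    obtain ⟨j, hj, hqj, hoj⟩ := hqm o' ho'
    have hij : i = j := hinj i hi j hj (by rw [← hqi, ← hqj, e])
    subst hij
    rcases hoi with ⟨h1, h2⟩ | ⟨k, hk, h1, h2⟩ <;> rcases hoj with ⟨h3, h4⟩ | ⟨k', hk', h3, h4⟩
    · rw [h2, h4]
    · omega
    · omega
    · rw [h2, h4, show k = k' by omega]
  · rintro o (rfl | ⟨i, hi, rfl⟩)
    · exact Or.inl rfl
    · exact Or.inr ⟨(hv i hi).2.2.1, (hv i hi).2.2.2.2⟩

/-- If the triangle of `m z` cannot be reached from that of `z`, then there is a cut. -/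
theorem exists_cut {z : V} {F : Set V}
    (hz : ¬ Relation.ReflTransGen (Step q m z F) (q z) (q (m z))) :
    ∃ U : Set V, (∀ v w, q v = q w → v ∈ U → w ∈ U) ∧ z ∈ U ∧ m z ∉ U ∧
      ∀ v ∈ U, m v ∉ U → v = z ∨ v ∈ F := by
  refine ⟨{v | Relation.ReflTransGen (Step q m z F) (q z) (q v)}, ?_, .refl, hz, ?_⟩
  · intro v w e hv
    rw [Set.mem_ofPred_eq, ← e]
    exact hv
  · intro v hv hmv
    by_contra! hcon
    refine hmv (Relation.ReflTransGen.tail hv ⟨v, rfl, rfl, hcon.1, ?_, hcon.2⟩)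
    rintro rfl
    exact hz hv

end TriangleStructure

/-! ### Crossing edges and closed sets -/

theorem IsKConnected.exists_crossing [Fintype V] {G : SimpleGraph V} {k : ℕ}
    (hG : G.IsKConnected k) {S : Finset V} (hS : S.card < k) {U : Set V} {a b : V} (ha : a ∈ U)
    (haS : a ∉ S) (hb : b ∉ U) (hbS : b ∉ S) :
    ∃ v w, G.Adj v w ∧ v ∈ U ∧ w ∉ U ∧ v ∉ S ∧ w ∉ S := by
  obtain ⟨p⟩ := (hG.2 S hS).preconnected ⟨a, haS⟩ ⟨b, hbS⟩
  obtain ⟨d, -, h1, h2⟩ := p.exists_boundary_dart (Subtype.val ⁻¹' U) ha hb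
  exact ⟨d.fst, d.snd, d.adj, h1, h2, d.fst.2, d.snd.2⟩

theorem Reachable.mem_of_closed {G : SimpleGraph V} {U : Set V}
    (hU : ∀ v w, G.Adj v w → v ∈ U → w ∈ U) {v w : V} (h : G.Reachable v w) (hv : v ∈ U) :
    w ∈ U := by
  obtain ⟨p⟩ := h
  induction p with
  | nil => exact hv
  | cons hadj _ ih => exact ih (hU _ _ hadj hv)

namespace TriangleStructure

variable {Q : Type*} {q : V → Q} {m : V → V}

/-! ### Existence of Λ-factors -/

/-- With the empty family of cycles, every triangle carries its own path. -/
theorem hasLambdaFactor_of_forall_exists_center (h : G.TriangleStructure q m) {E : Set (Sym2 V)}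
    (hE : ∀ v, ∃ b, q b = q v ∧ ∀ y, q y = q v → y ≠ b → s(b, y) ∉ E) :
    (G.deleteEdges E).HasLambdaFactor :=
  h.hasLambdaFactor_of_isExitSet (isExitSet_empty q m) (by simp) (by simp) fun v _ => hE v

/-- A cycle entering the triangle of `z` at `z` leaves it by `x` or `y`, so only the edge `xy` is
needed there. The set `F` collects forbidden exits: ends of deleted matching edges and, by `hD`, the
vertex `m c` whenever `c` is opposite a deleted edge `ab` of another triangle. Entering that
triangle at `c` would require `ab`. -/
theorem hasLambdaFactor_or_exists_cut (h : G.TriangleStructure q m) {x y z : V} (hxy : x ≠ y)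
    (hxz : x ≠ z) (hyz : y ≠ z) (hx : q x = q z) (hy : q y = q z) {E : Set (Sym2 V)} {F : Set V}
    (hxyE : s(x, y) ∉ E) (hzE : s(z, m z) ∉ E) (hext : ∀ v, s(v, m v) ∈ E → v ∈ F)
    (hD : ∀ a b c, a ≠ b → c ≠ a → c ≠ b → q a = q b → q c = q b → q a ≠ q z → s(a, b) ∈ E →
      s(c, a) ∉ E ∧ m c ∈ F) :
    (G.deleteEdges E).HasLambdaFactor ∨
    ∃ U : Set V, (∀ v w, q v = q w → v ∈ U → w ∈ U) ∧ z ∈ U ∧ m z ∉ U ∧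
      ∀ v ∈ U, m v ∉ U → v = z ∨ v ∈ F := by
  by_cases hreach : Relation.ReflTransGen (Step q m z F) (q z) (q (m z))
  swap
  · exact Or.inr (exists_cut hreach)
  left
  obtain ⟨O, hO, hmz, hOF⟩ := h.exists_isExitSet hreach
  have hzO : z ∉ O := by
    have := hO.entry_notMem _ hmz
    rwa [h.inv] at this
  refine h.hasLambdaFactor_of_isExitSet hO ?_ ?_ ?_
  · intro o ho
    rcases hOF o ho with rfl | ⟨-, h1⟩
    · rwa [h.inv, Sym2.eq_swap]
    · exact fun h2 => h1 (hext o h2)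
  · intro o ho y' hy' hne hmy' hE
    by_cases hoz : q o = q z
    · have h1 : o ≠ z := fun e => hzO (e ▸ ho)
      have h2 : y' ≠ z := fun e => hmy' (e ▸ hmz)
      rcases h.eq_of_class hxy hxz hyz hx hy hoz with rfl | rfl | h3
      · rcases h.eq_of_class hxy hxz hyz hx hy (hy'.trans hoz) with rfl | rfl | h4
        · exact hne rfl
        · exact hxyE hE
        · exact h2 h4
      · rcases h.eq_of_class hxy hxz hyz hx hy (hy'.trans hoz) with rfl | rfl | h4
        · exact hxyE (Sym2.eq_swap ▸ hE)
        · exact hne rfl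
        · exact h2 h4
      · exact h1 h3
    -- The needed edge joins the exit to the third vertex, so if it is deleted the entry `m o'` is
    -- the vertex opposite it, and `hD` forbids that entry.
    · obtain ⟨o', ho', hq'⟩ := hO.exists_entry o ho
      have h1 : m o' ≠ o := fun e => hO.entry_notMem o' ho' (e ▸ ho)
      have h2 : m o' ≠ y' := fun e => hmy' (by rw [← e, h.inv]; exact ho')
      have h3 := (hD o y' (m o') hne.symm h1 h2 hy'.symm (hq'.trans hy'.symm) hoz hE).2
      rw [h.inv] at h3
      rcases hOF o' ho' with rfl | ⟨-, h4⟩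
      · rw [h.inv] at hq'
        exact hoz hq'.symm
      · exact h4 h3
  · intro v hv
    have hvz : q v ≠ q z := by
      intro e
      obtain ⟨o, ho, hoq⟩ := hO.exists_exit _ hmz
      rw [h.inv] at hoq
      exact hv o ho (hoq.trans e.symm)
    -- An unvisited triangle with a deleted edge `ab` is centred at the opposite vertex `c`.
    by_cases hab : ∃ a b, a ≠ b ∧ q a = q v ∧ q b = q v ∧ s(a, b) ∈ E
    · obtain ⟨a, b, hne, ha, hb, habE⟩ := hab
      obtain ⟨c, hca, hcb, hc⟩ := h.exists_third a b
      refine ⟨c, hc.trans hb, ?_⟩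
      intro y' hy' hne'
      rcases h.eq_of_class hca.symm hne hcb (ha.trans hb.symm) hc (hy'.trans hb.symm) with
        rfl | rfl | rfl
      · exact (hD _ b c hne hca hcb (ha.trans hb.symm) hc (by rwa [ha]) habE).1
      · exact absurd rfl hne'
      · exact (hD _ a c hne.symm hcb hca (hb.trans ha.symm) (hc.trans (hb.trans ha.symm))
          (by rwa [hb]) (Sym2.eq_swap ▸ habE)).1
    · push Not at hab
      exact ⟨v, rfl, fun y' hy' hne' => hab v y' hne'.symm rfl hy'⟩

/-- Otherwise `z` would be a cut vertex, separating the other two vertices of its triangle from `b`.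
An edge leaving a union of triangles is necessarily a matching edge. -/
theorem exists_exit_ne [Fintype V] (h : G.TriangleStructure q m) (h2 : G.IsKConnected 2) {U : Set V}
    (hU : ∀ v w, q v = q w → v ∈ U → w ∈ U) {z b : V} (hz : z ∈ U) (hb : b ∉ U) :
    ∃ v ∈ U, m v ∉ U ∧ v ≠ z := by
  obtain ⟨x, -, -, hxz, -, hx, -⟩ := h.exists_others z
  obtain ⟨v, w, hadj, hv, hw, hvz, -⟩ := h2.exists_crossing (S := {z}) (by simp) (a := x) (b := b)
    (hU z x hx.symm hz) (by simpa using hxz) hb (by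
      rw [Finset.mem_singleton]
      rintro rfl
      exact hb hz)
  rcases (h.adj_iff _ _).1 hadj with ⟨-, h1⟩ | rfl
  · exact absurd (hU _ _ h1 hv) hw
  · exact ⟨v, hv, hw, by simpa using hvz⟩

/-- Two edges of a triangle deleted. -/
theorem hasLambdaFactor_of_two [Fintype V] (h : G.TriangleStructure q m) (h2 : G.IsKConnected 2) {x y z : V}
    (hxy : x ≠ y) (hxz : x ≠ z) (hyz : y ≠ z) (hx : q x = q z) (hy : q y = q z) {E : Set (Sym2 V)}
    (hE : ∀ e ∈ E, e = s(x, z) ∨ e = s(y, z)) : (G.deleteEdges E).HasLambdaFactor := by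
  have hq : ∀ a b, s(a, b) ∈ E → q a = q z ∧ q b = q z := by
    intro a b hab
    rcases hE _ hab with h1 | h1 <;> rcases Sym2.eq_iff.1 h1 with ⟨rfl, rfl⟩ | ⟨rfl, rfl⟩ <;>
      simp [hx, hy]
  have hm : ∀ v, s(v, m v) ∉ E := fun v hv => h.ne v ((hq _ _ hv).2.trans (hq _ _ hv).1.symm)
  have hxyE : s(x, y) ∉ E := by
    intro h1
    rcases hE _ h1 with h1 | h1 <;> simp [hxz, hyz, hxy] at h1
  rcases h.hasLambdaFactor_or_exists_cut hxy hxz hyz hx hy (E := E) (F := ∅) hxyE (hm z)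
    (fun v hv => absurd hv (hm v)) (fun a b c _ _ _ _ _ haz hab => absurd (hq _ _ hab).1 haz) with
    h1 | ⟨U, hU, hzU, hmzU, hcut⟩
  · exact h1
  · obtain ⟨v, hv, hmv, hvz⟩ := h.exists_exit_ne h2 hU hzU hmzU
    rcases hcut v hv hmv with h3 | h3
    · exact absurd h3 hvz
    · exact absurd h3 (Set.notMem_empty v)

/-- Two edges of a triangle and a non-triangle edge deleted. -/
theorem hasLambdaFactor_or_exists_cut_of_ext (h : G.TriangleStructure q m) {x y z u : V}
    (hxy : x ≠ y) (hxz : x ≠ z) (hyz : y ≠ z) (hx : q x = q z) (hy : q y = q z)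
    (huz : u ≠ z) (hmuz : m u ≠ z) {E : Set (Sym2 V)}
    (hE : ∀ e ∈ E, e = s(x, z) ∨ e = s(y, z) ∨ e = s(u, m u)) :
    (G.deleteEdges E).HasLambdaFactor ∨
    ∃ U : Set V, (∀ v w, q v = q w → v ∈ U → w ∈ U) ∧ z ∈ U ∧ m z ∉ U ∧
      ∀ v ∈ U, m v ∉ U → v = z ∨ v = u ∨ v = m u := by
  have hq : ∀ a b, s(a, b) ∈ E → (q a = q z ∧ q b = q z) ∨ (a = u ∧ b = m u) ∨ (a = m u ∧ b = u) := by
    intro a b hab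
    rcases hE _ hab with h1 | h1 | h1 <;> rcases Sym2.eq_iff.1 h1 with ⟨rfl, rfl⟩ | ⟨rfl, rfl⟩ <;>
      simp [hx, hy]
  have hm : ∀ v, s(v, m v) ∈ E → v = u ∨ v = m u := by
    intro v hv
    rcases hq _ _ hv with ⟨h1, h2⟩ | ⟨h1, -⟩ | ⟨h1, -⟩
    · exact absurd (h2.trans h1.symm) (h.ne v)
    · exact Or.inl h1
    · exact Or.inr h1
  refine h.hasLambdaFactor_or_exists_cut hxy hxz hyz hx hy (E := E) (F := {u, m u}) ?_ ?_
    hm (fun a b c hab _ _ hqab _ haz habE => ?_)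
  · intro h1
    rcases hq _ _ h1 with h1 | ⟨rfl, rfl⟩ | ⟨rfl, rfl⟩
    · rcases hE _ ‹_› with h1 | h1 | h1
      · simp [hxz, hyz] at h1
      · simp [hxz, hyz, hxy] at h1
      · rcases Sym2.eq_iff.1 h1 with ⟨rfl, rfl⟩ | ⟨rfl, rfl⟩
        · exact h.ne _ (hy.trans hx.symm)
        · exact h.ne _ (hx.trans hy.symm)
    · exact h.ne _ (hy.trans hx.symm)
    · exact h.ne _ (hx.trans hy.symm)
  · intro h1
    rcases hm _ h1 with h1 | h1
    · exact huz h1.symm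
    · exact hmuz h1.symm
  · rcases hq _ _ habE with h1 | ⟨rfl, rfl⟩ | ⟨rfl, rfl⟩
    · exact absurd h1.1 haz
    · exact absurd hqab.symm (h.ne _)
    · exact absurd hqab (h.ne _)

/-- In a cut `U`, 2-connectivity forces `x` to be the second exit besides `z`, so `m y` stays in
`U`. The part of `U` outside the triangle is then attached to the rest only at `m y`, a cut vertex.
-/
theorem hasLambdaFactor_of_path [Fintype V] (h : G.TriangleStructure q m) (h2 : G.IsKConnected 2) {x y z : V}
    (hxy : x ≠ y) (hxz : x ≠ z) (hyz : y ≠ z) (hx : q x = q z) (hy : q y = q z) {E : Set (Sym2 V)}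
    (hE : ∀ e ∈ E, e = s(x, z) ∨ e = s(y, z) ∨ e = s(x, m x)) :
    (G.deleteEdges E).HasLambdaFactor := by
  have hmxz : m x ≠ z := fun e => h.ne x (by rw [e, hx])
  rcases h.hasLambdaFactor_or_exists_cut_of_ext hxy hxz hyz hx hy hxz hmxz hE with
    h1 | ⟨U, hU, hzU, hmzU, hcut⟩
  · exact h1
  exfalso
  have hxU : x ∈ U := hU _ _ hx.symm hzU
  have hyU : y ∈ U := hU _ _ hy.symm hzU
  have hmxU : m x ∉ U := by
    obtain ⟨v, hv, hmv, hvz⟩ := h.exists_exit_ne h2 hU hzU hmzU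
    rcases hcut v hv hmv with rfl | rfl | rfl
    · exact absurd rfl hvz
    · exact hmv
    · rw [h.inv] at hmv
      exact absurd hxU hmv
  have hmyU : m y ∈ U := by
    by_contra hmy
    rcases hcut y hyU hmy with h1 | h1 | h1
    · exact hyz h1
    · exact hxy h1.symm
    · rw [h1] at hyU
      exact hmxU hyU
  obtain ⟨v, ⟨hv, hvq⟩, hmv, hvne⟩ := h.exists_exit_ne h2 (U := {v | v ∈ U ∧ q v ≠ q z})
    (fun v w e hv => ⟨hU v w e hv.1, e ▸ hv.2⟩) (z := m y) (b := z)
    ⟨hmyU, hy ▸ h.ne y⟩ (fun h1 => h1.2 rfl)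
  by_cases hmvU : m v ∈ U
  · have h1 : q (m v) = q z := by
      by_contra h1
      exact hmv ⟨hmvU, h1⟩
    rcases h.eq_of_class hxy hxz hyz hx hy h1 with h1 | h1 | h1
    · exact hmxU (by rwa [← h1, h.inv])
    · exact hvne (by rw [← h1, h.inv])
    · exact hmzU (by rwa [← h1, h.inv])
  · rcases hcut v hv hmvU with rfl | rfl | rfl
    · exact hvq rfl
    · exact hvq hx
    · exact hmxU hv

/-- Two edges of a triangle and a disjoint non-triangle edge deleted. -/
theorem not_connected_of_no_factor_ext (h : G.TriangleStructure q m) {x y z u : V}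
    (hxy : x ≠ y) (hxz : x ≠ z) (hyz : y ≠ z) (hx : q x = q z) (hy : q y = q z)
    (hu : q u ≠ q z) (hmu : q (m u) ≠ q z) {E : Set (Sym2 V)}
    (hE : E = {s(x, z), s(y, z), s(u, m u)}) (hno : ¬ (G.deleteEdges E).HasLambdaFactor) :
    ¬ (G.deleteEdges E).Connected := by
  have huz : u ≠ z := fun e => hu (by rw [e])
  have hmuz : m u ≠ z := fun e => hmu (by rw [e])
  obtain ⟨U, hU, hzU, hmzU, hcut⟩ := (h.hasLambdaFactor_or_exists_cut_of_ext hxy hxz hyz hx hy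
    huz hmuz (by rw [hE]; simp)).resolve_left hno
  intro hconn
  -- The set `U \ {z}` is closed in `G - E`: the edges `xz`, `yz` are deleted, and the only exits of
  -- `U` are `z` and an end of the deleted edge at `u`.
  have h1 := (hconn.preconnected x z).mem_of_closed (U := U \ {z}) ?_ ⟨hU _ _ hx.symm hzU, hxz⟩
  · exact h1.2 rfl
  · rintro v w hvw ⟨hv, hvz⟩
    rw [deleteEdges_adj] at hvw
    rcases (h.adj_iff _ _).1 hvw.1 with ⟨hne, hq⟩ | rfl
    · refine ⟨hU _ _ hq hv, ?_⟩
      rintro rfl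
      apply hvw.2
      rw [hE]
      rcases h.eq_of_class hxy hxz hyz hx hy hq with rfl | rfl | h3
      · simp
      · simp
      · exact absurd h3 hvz
    · refine ⟨?_, ?_⟩
      · by_contra hmv
        rcases hcut v hv hmv with h3 | rfl | rfl
        · exact hvz h3
        · exact hvw.2 (by rw [hE]; simp)
        · exact hvw.2 (by rw [hE, h.inv, Sym2.eq_swap]; simp)
      · intro h3
        have h4 : m v = z := h3
        rw [← h4, h.inv] at hmzU
        exact hmzU hv

/-- Two edges of a triangle and an edge of another triangle deleted. -/
theorem exists_cut_of_no_factor [Fintype V] (h : G.TriangleStructure q m) (h2 : G.IsKConnected 2)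
    {x y z a b c : V} (hxy : x ≠ y) (hxz : x ≠ z) (hyz : y ≠ z) (hx : q x = q z) (hy : q y = q z)
    (hab : a ≠ b) (hac : a ≠ c) (hbc : b ≠ c) (ha : q a = q c) (hb : q b = q c) (hcz : q c ≠ q z)
    {E : Set (Sym2 V)} (hE : E = {s(x, z), s(y, z), s(a, b)})
    (hno : ¬ (G.deleteEdges E).HasLambdaFactor) :
    ¬ (G.deleteEdges {s(c, m c), s(z, m z)}).Reachable a x := by
  have hq : ∀ v w, s(v, w) ∈ E → (q v = q z ∧ q w = q z) ∨ (v = a ∧ w = b) ∨ (v = b ∧ w = a) := by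
    intro v w hvw
    rw [hE] at hvw
    rcases hvw with h1 | h1 | h1 <;>
      rcases Sym2.eq_iff.1 h1 with ⟨rfl, rfl⟩ | ⟨rfl, rfl⟩ <;> simp [hx, hy]
  have hm : ∀ v, s(v, m v) ∉ E := by
    intro v hv
    rcases hq _ _ hv with ⟨h1, h2⟩ | ⟨h1, h2⟩ | ⟨h1, h2⟩
    · exact h.ne v (h2.trans h1.symm)
    · exact h.ne v (by rw [h2, h1, ha, hb])
    · exact h.ne v (by rw [h2, h1, ha, hb])
  have hxyE : s(x, y) ∉ E := by
    intro h1
    rw [hE] at h1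
    rcases h1 with h1 | h1 | h1
    · simp [hxz, hyz] at h1
    · simp [hxz, hyz, hxy] at h1
    · rcases Sym2.eq_iff.1 h1 with ⟨rfl, rfl⟩ | ⟨rfl, rfl⟩
      · exact hcz (ha.symm.trans hx)
      · exact hcz (hb.symm.trans hx)
  have hD : ∀ a' b' c', a' ≠ b' → c' ≠ a' → c' ≠ b' → q a' = q b' → q c' = q b' → q a' ≠ q z →
      s(a', b') ∈ E → s(c', a') ∉ E ∧ m c' ∈ ({m c} : Set V) := by
    intro a' b' c' hab' hca' hcb' hqab hqc haz habE
    have hc' : c' = c := by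
      have hqc' : q c' = q c ∧ q a' = q c := by
        rcases hq _ _ habE with h1 | ⟨rfl, rfl⟩ | ⟨rfl, rfl⟩
        · exact absurd h1.1 haz
        · exact ⟨hqc.trans hb, ha⟩
        · exact ⟨hqc.trans ha, hb⟩
      rcases h.eq_of_class hab hac hbc ha hb hqc'.1 with h1 | h1 | h1
      · rcases hq _ _ habE with h3 | ⟨rfl, rfl⟩ | ⟨rfl, rfl⟩
        · exact absurd h3.1 haz
        · exact absurd h1 hca'
        · exact absurd h1 hcb'
      · rcases hq _ _ habE with h3 | ⟨rfl, rfl⟩ | ⟨rfl, rfl⟩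
        · exact absurd h3.1 haz
        · exact absurd h1 hcb'
        · exact absurd h1 hca'
      · exact h1
    subst hc'
    refine ⟨fun h1 => ?_, rfl⟩
    rcases hq _ _ h1 with h3 | ⟨h3, -⟩ | ⟨h3, -⟩
    · exact hcz h3.1
    · exact hac h3.symm
    · exact hbc h3.symm
  -- Only entry at `c`, opposite the deleted edge `ab`, has to be forbidden. The second exit of `U`
  -- is then `m c`, so the matching edges at `c` and `z` separate `a` from `x`.
  obtain ⟨U, hU, hzU, hmzU, hcut⟩ := (h.hasLambdaFactor_or_exists_cut hxy hxz hyz hx hy (E := E)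
    (F := {m c}) hxyE (hm z) (fun v hv => absurd hv (hm v)) hD).resolve_left hno
  · obtain ⟨v, hv, hmv, hvz⟩ := h.exists_exit_ne h2 hU hzU hmzU
    have h1 : v = m c := (hcut v hv hmv).resolve_left hvz
    rw [h1, h.inv] at hmv
    intro hreach
    refine hmv (hU a c ha ?_)
    refine hreach.symm.mem_of_closed (U := U) ?_ (hU _ _ hx.symm hzU)
    intro v w hvw hvU
    rw [deleteEdges_adj] at hvw
    rcases (h.adj_iff _ _).1 hvw.1 with ⟨-, h3⟩ | rfl
    · exact hU _ _ h3 hvU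
    · by_contra hw
      rcases hcut v hvU hw with h3 | h3
      · exact hvw.2 (by rw [h3]; simp)
      · have h4 : v = m c := h3
        exact hvw.2 (by rw [h4, h.inv, Sym2.eq_swap]; simp)

/-! ### Obstructions to Λ-factors -/

/-- Only the matching edge can survive at `z`, whereas a centre needs two neighbours; so `z` is a
leaf. -/
theorem center_eq_m (h : G.TriangleStructure q m) {x y z : V} (hxy : x ≠ y)
    (hxz : x ≠ z) (hyz : y ≠ z) (hx : q x = q z) (hy : q y = q z) {E : Set (Sym2 V)}
    (hxE : s(x, z) ∈ E) (hyE : s(y, z) ∈ E) {f : V → V} (hf : (G.deleteEdges E).IsCenterMap f) :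
    f z = m z := by
  have hadj : ∀ w, (G.deleteEdges E).Adj w z → w = m z := by
    intro w hw
    rw [deleteEdges_adj] at hw
    rcases (h.adj_iff _ _).1 hw.1 with ⟨hne, hq⟩ | h1
    · rcases h.eq_of_class hxy hxz hyz hx hy hq with rfl | rfl | h1
      · exact absurd hxE hw.2
      · exact absurd hyE hw.2
      · exact absurd h1 hne
    · rw [h1, h.inv]
  by_cases hz : f z = z
  · obtain ⟨u, w, huw, -, -, hu, hw, -⟩ := hf.exists_two_adj hz
    exact absurd ((hadj u hu).trans (hadj w hw).symm) huw
  · exact hadj _ (hf.adj z (Ne.symm hz)).symm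

theorem not_hasLambdaFactor_of_isolated {H : SimpleGraph V} {z : V} (hz : ∀ w, ¬ H.Adj z w) :
    ¬ H.HasLambdaFactor := by
  rw [hasLambdaFactor_iff]
  rintro ⟨f, hf⟩
  by_cases hfz : f z = z
  · obtain ⟨u, w, -, -, -, hu, -⟩ := hf.exists_two_adj hfz
    exact hz u hu.symm
  · exact hz _ (hf.adj z (Ne.symm hfz))

/-- The triangle must contain a centre, but each of its vertices retains at most its matching edge.
-/
theorem not_hasLambdaFactor_of_triangle [Fintype V] (h : G.TriangleStructure q m) {z : V} {E : Set (Sym2 V)}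
    (hE : ∀ v w, v ≠ w → q v = q z → q w = q z → s(v, w) ∈ E) :
    ¬ (G.deleteEdges E).HasLambdaFactor := by
  rw [hasLambdaFactor_iff]
  rintro ⟨f, hf⟩
  obtain ⟨b, hbz, hb⟩ := h.exists_center (deleteEdges_le E) hf z
  obtain ⟨u, w, huw, hub, hwb, hu, hw, -⟩ := hf.exists_two_adj hb
  have hadj : ∀ w, w ≠ b → (G.deleteEdges E).Adj w b → w = m b := by
    intro w hwb hw
    rw [deleteEdges_adj] at hw
    rcases (h.adj_iff _ _).1 hw.1 with ⟨hne, hq⟩ | h1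
    · exact absurd (hE w b hne (hq.trans hbz) hbz) hw.2
    · rw [h1, h.inv]
  exact huw ((hadj u hub hu).trans (hadj w hwb hw).symm)

/-- If `z` still reached `x`, the vertices not reachable from `z` would form a union of triangles
with a single exit. Hence the component of `z`, without `z`, is a union of triangles. The path of
`z` has its centre there, so some path of that set must have its centre outside; within the
component that centre can only be the leaf `z`. -/
theorem not_hasLambdaFactor_of_not_connected [Fintype V] (h : G.TriangleStructure q m)
    (h2 : G.IsKConnected 2) {x y z u : V} (hxy : x ≠ y) (hxz : x ≠ z) (hyz : y ≠ z) (hx : q x = q z)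
    (hy : q y = q z) (hu : q u ≠ q z) {E : Set (Sym2 V)}
    (hE : E = {s(x, z), s(y, z), s(u, m u)}) (hconn : ¬ (G.deleteEdges E).Connected) :
    ¬ (G.deleteEdges E).HasLambdaFactor := by
  rw [hasLambdaFactor_iff]
  rintro ⟨f, hf⟩
  have hfz := h.center_eq_m hxy hxz hyz hx hy (by rw [hE]; simp) (by rw [hE]; simp) hf
  have hq : ∀ v w, s(v, w) ∈ E → (q v = q z ∧ q w = q z ∧ (v = z ∨ w = z)) ∨
      (v = u ∧ w = m u) ∨ (v = m u ∧ w = u) := by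
    intro v w hvw
    rw [hE] at hvw
    rcases hvw with h1 | h1 | h1 <;>
      rcases Sym2.eq_iff.1 h1 with ⟨rfl, rfl⟩ | ⟨rfl, rfl⟩ <;> simp [hx, hy]
  have hadj_q : ∀ v w, v ≠ w → q v = q w → q v ≠ q z → (G.deleteEdges E).Adj v w := by
    intro v w hne hvw hvz
    rw [deleteEdges_adj]
    refine ⟨h.adj_of_q hne hvw, fun h1 => ?_⟩
    rcases hq _ _ h1 with h3 | ⟨rfl, rfl⟩ | ⟨rfl, rfl⟩
    · exact hvz h3.1
    · exact h.ne _ hvw.symm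
    · exact h.ne _ hvw
  have hxyadj : (G.deleteEdges E).Adj x y := by
    rw [deleteEdges_adj]
    refine ⟨h.adj_of_q hxy (hx.trans hy.symm), fun h1 => ?_⟩
    rcases hq _ _ h1 with ⟨-, -, h3⟩ | ⟨rfl, rfl⟩ | ⟨rfl, rfl⟩
    · exact h3.elim hxz hyz
    · exact h.ne _ (hy.trans hx.symm)
    · exact h.ne _ (hx.trans hy.symm)
  have hzmadj : (G.deleteEdges E).Adj z (m z) := by
    have := hf.adj z (by rw [hfz]; exact (h.m_ne z).symm)
    rwa [hfz] at this
  by_cases hxC : (G.deleteEdges E).Reachable z x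
  · have hyC : (G.deleteEdges E).Reachable z y := hxC.trans hxyadj.reachable
    obtain ⟨w, hw⟩ : ∃ w, ¬ (G.deleteEdges E).Reachable z w := by
      by_contra! hall
      have : Nonempty V := ⟨z⟩
      exact hconn ⟨fun v w => (hall v).symm.trans (hall w)⟩
    have hS : ∀ v w, q v = q w → v ∈ {w | ¬ (G.deleteEdges E).Reachable z w} →
        w ∈ {w | ¬ (G.deleteEdges E).Reachable z w} := by
      intro v w hvw hv hw
      by_cases hne : v = w
      · exact hv (hne ▸ hw)
      by_cases hvz : q v = q z
      · rcases h.eq_of_class hxy hxz hyz hx hy hvz with rfl | rfl | rfl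
        · exact hv hxC
        · exact hv hyC
        · exact hv (Reachable.refl _)
      · exact hv (hw.trans (hadj_q v w hne hvw hvz).symm.reachable)
    have hexit : ∀ v, ¬ (G.deleteEdges E).Reachable z v → (G.deleteEdges E).Reachable z (m v) →
        v = u ∨ v = m u := by
      intro v hv hmv
      by_contra! hcon
      apply hv
      refine hmv.trans (Adj.reachable ?_)
      rw [adj_comm, deleteEdges_adj]
      refine ⟨h.adj_m v, fun h1 => ?_⟩
      rcases hq _ _ h1 with ⟨h3, h4, -⟩ | ⟨h3, -⟩ | ⟨h3, -⟩
      · exact h.ne v (h4.trans h3.symm)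
      · exact hcon.1 h3
      · exact hcon.2 h3
    -- Two distinct exits would have to be `u` and `m u`, but these are matched and cannot both lie
    -- in the set.
    obtain ⟨v, hv, hmv, -⟩ := h.exists_exit_ne h2 hS (z := w) (b := z) hw
      (fun h1 => h1 (Reachable.refl _))
    obtain ⟨v', hv', hmv', hne⟩ := h.exists_exit_ne h2 hS (z := v) (b := z) hv
      (fun h1 => h1 (Reachable.refl _))
    have h3 := hexit v hv (not_not.1 hmv)
    have h4 := hexit v' hv' (not_not.1 hmv')
    rcases h3 with rfl | rfl <;> rcases h4 with rfl | rfl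
    · exact hne rfl
    · exact hmv hv'
    · rw [h.inv] at hmv
      exact hmv hv'
    · exact hne rfl
  · have hyC : ¬ (G.deleteEdges E).Reachable z y := fun h1 => hxC (h1.trans hxyadj.symm.reachable)
    have hS : ∀ v w, q v = q w → v ∈ {w | (G.deleteEdges E).Reachable z w ∧ w ≠ z} →
        w ∈ {w | (G.deleteEdges E).Reachable z w ∧ w ≠ z} := by
      intro v w hvw hv
      have hvz : q v ≠ q z := by
        intro hvz
        rcases h.eq_of_class hxy hxz hyz hx hy hvz with rfl | rfl | rfl
        · exact hxC hv.1
        · exact hyC hv.1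
        · exact hv.2 rfl
      by_cases hne : v = w
      · exact hne ▸ hv
      · exact ⟨hv.1.trans (hadj_q v w hne hvw hvz).reachable, fun e => hvz (e ▸ hvw)⟩
    obtain ⟨w, hw, hfw⟩ := h.exists_center_entering (deleteEdges_le E) hf
      (S := {w | (G.deleteEdges E).Reachable z w ∧ w ≠ z}ᶜ)
      (fun v w e hv hw => hv (hS w v e.symm hw)) (v := z) (fun h1 => h1.2 rfl)
      (fun h1 => h1 ⟨by rw [hfz]; exact hzmadj.reachable, by rw [hfz]; exact h.m_ne z⟩)
    have hw' := not_not.1 hw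
    have hwf : w ≠ f w := fun e => hfw (e ▸ hw')
    have h1 : (G.deleteEdges E).Reachable z (f w) := hw'.1.trans (hf.adj w hwf).reachable
    have h3 : f w = z := by
      by_contra h3
      exact hfw ⟨h1, h3⟩
    have h4 := hf.idem w
    rw [h3, hfz] at h4
    exact h.m_ne z h4

/-- The component `S` of `x` is a union of triangles whose only exits are `z` and `m c`. The path of
`z` has its centre outside `S`, so by balance some path has a leaf outside and its centre in `S`;
this makes `c` a leaf of `m c`. Its triangle, lacking `ab`, is then left without a possible centre.
-/
theorem not_hasLambdaFactor_of_not_reachable [Fintype V] (h : G.TriangleStructure q m)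
    (h2 : G.IsKConnected 2) {x y z a b c : V} (hxy : x ≠ y) (hxz : x ≠ z) (hyz : y ≠ z)
    (hx : q x = q z) (hy : q y = q z) (hab : a ≠ b) (hac : a ≠ c) (hbc : b ≠ c) (ha : q a = q c)
    (hb : q b = q c) {E : Set (Sym2 V)} (hxE : s(x, z) ∈ E) (hyE : s(y, z) ∈ E)
    (habE : s(a, b) ∈ E) (hreach : ¬ (G.deleteEdges {s(c, m c), s(z, m z)}).Reachable a x) :
    ¬ (G.deleteEdges E).HasLambdaFactor := by
  rw [hasLambdaFactor_iff]
  rintro ⟨f, hf⟩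
  have hfz := h.center_eq_m hxy hxz hyz hx hy hxE hyE hf
  obtain ⟨S, hSdef⟩ : ∃ S : Set V,
    ∀ v, v ∈ S ↔ (G.deleteEdges {s(c, m c), s(z, m z)}).Reachable x v := ⟨{v | _}, fun _ => Iff.rfl⟩
  have hS : ∀ v w, q v = q w → v ∈ S → w ∈ S := by
    intro v w hvw hv
    by_cases hne : v = w
    · exact hne ▸ hv
    rw [hSdef] at hv ⊢
    refine hv.trans (Adj.reachable ?_)
    rw [deleteEdges_adj]
    refine ⟨h.adj_of_q hne hvw, ?_⟩
    rintro (h1 | h1) <;> rcases Sym2.eq_iff.1 h1 with ⟨rfl, rfl⟩ | ⟨rfl, rfl⟩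
    · exact h.ne _ hvw.symm
    · exact h.ne _ hvw
    · exact h.ne _ hvw.symm
    · exact h.ne _ hvw
  have hxS : x ∈ S := (hSdef x).2 (Reachable.refl _)
  have hzS : z ∈ S := hS _ _ hx hxS
  have haS : a ∉ S := fun h1 => hreach ((hSdef a).1 h1).symm
  have hcS : c ∉ S := fun h1 => haS (hS _ _ ha.symm h1)
  have hexit : ∀ v ∈ S, m v ∉ S → v = z ∨ v = m c := by
    intro v hv hmv
    by_contra! hcon
    refine hmv ((hSdef _).2 (((hSdef _).1 hv).trans (Adj.reachable ?_)))
    rw [deleteEdges_adj]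
    refine ⟨h.adj_m v, ?_⟩
    rintro (h1 | h1) <;> rcases Sym2.eq_iff.1 h1 with ⟨h3, h4⟩ | ⟨h3, h4⟩
    · exact hcS (h3 ▸ hv)
    · exact hcon.2 h3
    · exact hcon.1 h3
    · exact hmv (h4 ▸ hzS)
  obtain ⟨v, hv, hmv, hvz⟩ := h.exists_exit_ne h2 hS hzS haS
  have hv' := (hexit v hv hmv).resolve_left hvz
  subst hv'
  have hmzS : m z ∉ S := by
    obtain ⟨w, hw, hmw, hwne⟩ := h.exists_exit_ne h2 hS hv haS
    have := (hexit w hw hmw).resolve_right hwne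
    rwa [this] at hmw
  obtain ⟨w, hw, hfw⟩ := h.exists_center_entering (deleteEdges_le E) hf hS hzS (by rwa [hfz])
  have hwf : w ≠ f w := fun e => hw (e ▸ hfw)
  have hfwm : f w = m w := by
    have h1 := hf.adj w hwf
    rw [deleteEdges_adj] at h1
    rcases (h.adj_iff _ _).1 h1.1 with ⟨-, h3⟩ | h3
    · exact absurd (hS _ _ h3.symm hfw) hw
    · exact h3
  rw [hfwm] at hfw
  -- The other crossing edge would make `z` a centre.
  have hwc : w = c := by
    rcases hexit (m w) hfw (by rwa [h.inv]) with h1 | h1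
    · exfalso
      have h3 := hf.idem w
      rw [hfwm, h1, hfz] at h3
      exact h.m_ne z h3
    · exact h.m_inj h1
  subst hwc
  -- As a centre, `a` could have only the leaf `m a`: the edge `ab` is deleted and `w` already
  -- belongs to the path centred at `m w`.
  have key : ∀ a b, a ≠ w → a ≠ b → b ≠ w → q a = q w → q b = q w → s(a, b) ∈ E → f a ≠ a := by
    intro a b haw hab hbw ha hb hE hfa
    obtain ⟨u, v, huv, -, -, hu, hv, hfu, hfv⟩ := hf.exists_two_adj hfa
    have hadj : ∀ u, (G.deleteEdges E).Adj u a → f u = a → u = m a := by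
      intro u hu hfu
      rw [deleteEdges_adj] at hu
      rcases (h.adj_iff _ _).1 hu.1 with ⟨hne, hq⟩ | h1
      · rcases h.eq_of_class hab haw hbw ha hb (hq.trans ha) with rfl | rfl | rfl
        · exact absurd rfl hne
        · exact absurd (Sym2.eq_swap ▸ hE) hu.2
        · rw [hfwm] at hfu
          exact absurd (by rw [hfu, ha]) (h.ne u)
      · rw [h1, h.inv]
    exact huv ((hadj u hu hfu).trans (hadj v hv hfv).symm)
  obtain ⟨d, hd, hfd⟩ := h.exists_center (deleteEdges_le E) hf w
  rcases h.eq_of_class hab hac hbc ha hb hd with rfl | rfl | rfl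
  · exact key _ b hac hab hbc ha hb habE hfd
  · exact key _ a hbc hab.symm hac hb ha (Sym2.eq_swap ▸ habE) hfd
  · exact h.m_ne d (hfwm.symm.trans hfd)

end TriangleStructure

/-! ### Components, triangles and claws as subgraphs -/

namespace Subgraph

theorem Connected.verts_subset_of_closed {K : G.Subgraph} (hK : K.Connected) {S : Set V}
    (hS : ∀ u w, K.Adj u w → u ∈ S → w ∈ S) {v : V} (hv : v ∈ K.verts) (hvS : v ∈ S) :
    K.verts ⊆ S := by
  intro w hw
  exact (hK.coe.preconnected ⟨v, hv⟩ ⟨w, hw⟩).mem_of_closed (U := Subtype.val ⁻¹' S)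
    (fun a b hab ha => hS a b hab ha) hvS

theorem Connected.le_left_of_le_sup {A B K : G.Subgraph} (hK : K.Connected)
    (hd : Disjoint A.verts B.verts) (hKAB : K ≤ A ⊔ B) {v : V} (hv : v ∈ K.verts)
    (hvA : v ∈ A.verts) : K ≤ A := by
  have hadj : ∀ u w, K.Adj u w → u ∈ A.verts → A.Adj u w := by
    intro u w huw hu
    rcases hKAB.2 huw with h1 | h1
    · exact h1
    · exact absurd hu (Set.disjoint_right.1 hd (B.edge_vert h1))
  have hsub := hK.verts_subset_of_closed (fun u w huw hu => A.edge_vert (hadj u w huw hu).symm) hv hvA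
  exact ⟨hsub, fun u w huw => hadj u w huw (hsub (K.edge_vert huw))⟩

/-- A connected subgraph of a disjoint union stays inside one of the two parts. -/
theorem components_sup {A B : G.Subgraph} (hA : A.Connected) (hB : B.Connected)
    (hd : Disjoint A.verts B.verts) : (A ⊔ B).components = {A, B} := by
  have hle : ∀ K : G.Subgraph, K ≤ A ⊔ B → K.Connected → K ≤ A ∨ K ≤ B := by
    intro K hK hKc
    obtain ⟨v, hv⟩ := hKc.nonempty
    rcases hK.1 hv with h1 | h1
    · exact Or.inl (hKc.le_left_of_le_sup hd hK hv h1)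
    · exact Or.inr (hKc.le_left_of_le_sup hd.symm (by rwa [sup_comm]) hv h1)
  have hmax : ∀ A B : G.Subgraph, A.Connected → Disjoint A.verts B.verts → ¬ A ≤ B := by
    intro A B hA hd h1
    obtain ⟨v, hv⟩ := hA.nonempty
    exact Set.disjoint_left.1 hd hv (h1.1 hv)
  ext K
  constructor
  · rintro ⟨⟨hK, hKc⟩, hKmax⟩
    rcases hle K hK hKc with h1 | h1
    · exact Or.inl (le_antisymm h1 (hKmax ⟨le_sup_left, hA⟩ h1))
    · exact Or.inr (le_antisymm h1 (hKmax ⟨le_sup_right, hB⟩ h1))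
  · rintro (rfl | rfl)
    · refine ⟨⟨le_sup_left, hA⟩, ?_⟩
      rintro L ⟨hL, hLc⟩ hKL
      exact (hle L hL hLc).resolve_right fun h1 => hmax _ _ hA hd (hKL.trans h1)
    · refine ⟨⟨le_sup_right, hB⟩, ?_⟩
      rintro L ⟨hL, hLc⟩ hKL
      exact (hle L hL hLc).resolve_left fun h1 => hmax _ _ hB hd.symm (hKL.trans h1)

/-- Were they to meet, their union would be connected and contradict maximality. -/
theorem disjoint_of_mem_components {H A B : G.Subgraph} (hA : A ∈ H.components)
    (hB : B ∈ H.components) (hne : A ≠ B) : Disjoint A.verts B.verts := by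
  rw [Set.disjoint_iff_inter_eq_empty, ← Set.not_nonempty_iff_eq_empty]
  intro hAB
  have hc : (A ⊔ B).Connected := connected_sup hA.1.2.preconnected hB.1.2.preconnected hAB
  have hle : A ⊔ B ≤ H := sup_le hA.1.1 hB.1.1
  exact hne (le_antisymm (le_sup_left.trans (hB.2 ⟨hle, hc⟩ le_sup_right))
    (le_sup_right.trans (hA.2 ⟨hle, hc⟩ le_sup_left)))

theorem isTriangle_of_verts_eq {T : G.Subgraph} {x y z : V} (hxy : T.Adj x y) (hxz : T.Adj x z)
    (hyz : T.Adj y z) (hverts : T.verts = {x, y, z}) : T.IsTriangle := by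
  let f : Fin 3 → T.verts :=
    ![⟨x, T.edge_vert hxy⟩, ⟨y, T.edge_vert hyz⟩, ⟨z, T.edge_vert hyz.symm⟩]
  have hf : Function.Bijective f := by
    constructor
    · intro i j hij
      have hij' : (f i).1 = (f j).1 := congrArg Subtype.val hij
      fin_cases i <;> fin_cases j <;>
        first
        | rfl
        | exact absurd hij' hxy.ne
        | exact absurd hij' hxz.ne
        | exact absurd hij' hyz.ne
        | exact absurd hij'.symm hxy.ne
        | exact absurd hij'.symm hxz.ne
        | exact absurd hij'.symm hyz.ne
    · rintro ⟨w, hw⟩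
      have hw' := hw
      rw [hverts] at hw'
      rcases hw' with rfl | rfl | rfl
      · exact ⟨0, rfl⟩
      · exact ⟨1, rfl⟩
      · exact ⟨2, rfl⟩
  have hirr : ∀ v, ¬ T.Adj v v := fun v h => h.ne rfl
  refine ⟨RelIso.symm ⟨Equiv.ofBijective f hf, ?_⟩⟩
  intro i j
  change T.Adj (f i).1 (f j).1 ↔ _
  fin_cases i <;> fin_cases j <;> simp [f, hxy, hxz, hyz, hxy.symm, hxz.symm, hyz.symm, hirr]

theorem IsTriangle.exists_verts_eq {T : G.Subgraph} (hT : T.IsTriangle) :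
    ∃ x y z, T.Adj x y ∧ T.Adj x z ∧ T.Adj y z ∧ T.verts = {x, y, z} := by
  obtain ⟨φ⟩ := hT
  have hadj : ∀ i j : Fin 3, i ≠ j → T.Adj (φ.symm i).1 (φ.symm j).1 :=
    fun i j hij => φ.symm.map_rel_iff.2 hij
  refine ⟨(φ.symm 0).1, (φ.symm 1).1, (φ.symm 2).1, hadj _ _ (by decide), hadj _ _ (by decide),
    hadj _ _ (by decide), ?_⟩
  ext w
  simp only [Set.mem_insert_iff, Set.mem_singleton_iff]
  constructor
  · intro hw
    obtain ⟨i, hi⟩ := φ.symm.surjective ⟨w, hw⟩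
    have hwi : w = (φ.symm i).1 := by rw [hi]
    fin_cases i
    · exact Or.inl hwi
    · exact Or.inr (Or.inl hwi)
    · exact Or.inr (Or.inr hwi)
  · rintro (rfl | rfl | rfl) <;> exact Subtype.prop _

theorem IsTriangle.adj {T : G.Subgraph} (hT : T.IsTriangle) {v w : V} (hv : v ∈ T.verts)
    (hw : w ∈ T.verts) (hne : v ≠ w) : T.Adj v w := by
  obtain ⟨φ⟩ := hT
  have : (completeGraph (Fin 3)).Adj (φ ⟨v, hv⟩) (φ ⟨w, hw⟩) := by
    intro h1
    exact hne (congrArg Subtype.val (φ.injective h1))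
  exact φ.map_rel_iff.1 this

theorem IsTriangle.ncard_verts {T : G.Subgraph} (hT : T.IsTriangle) : T.verts.ncard = 3 := by
  obtain ⟨x, y, z, hxy, hxz, hyz, h⟩ := hT.exists_verts_eq
  exact Set.ncard_eq_three.2 ⟨x, y, z, hxy.ne, hxz.ne, hyz.ne, h⟩

theorem IsTriangle.eq_of_verts_eq {T T' : G.Subgraph} (hT : T.IsTriangle) (hT' : T'.IsTriangle)
    (h : T.verts = T'.verts) : T = T' := by
  apply Subgraph.ext h
  ext v w
  exact ⟨fun h1 => hT'.adj (h ▸ T.edge_vert h1) (h ▸ T.edge_vert h1.symm) h1.ne,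
    fun h1 => hT.adj (h ▸ T'.edge_vert h1) (h ▸ T'.edge_vert h1.symm) h1.ne⟩

theorem IsClaw.exists_adj {H : G.Subgraph} (hH : H.IsClaw) :
    ∃ z a b c, a ≠ b ∧ a ≠ c ∧ b ≠ c ∧ H.Adj z a ∧ H.Adj z b ∧ H.Adj z c := by
  obtain ⟨φ⟩ := hH
  have hadj : ∀ i : Fin 3, H.Adj (φ.symm (Sum.inl 0)).1 (φ.symm (Sum.inr i)).1 :=
    fun i => φ.symm.map_rel_iff.2 (by simp [completeBipartiteGraph])
  have hne : ∀ i j : Fin 3, i ≠ j → (φ.symm (Sum.inr i)).1 ≠ (φ.symm (Sum.inr j)).1 :=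
    fun i j hij h1 => hij (Sum.inr_injective (φ.symm.injective (Subtype.ext h1)))
  exact ⟨_, _, _, _, hne 0 1 (by decide), hne 0 2 (by decide), hne 1 2 (by decide), hadj 0, hadj 1,
    hadj 2⟩

theorem isClaw_of_adj {H : G.Subgraph} {z a b c : V} (hab : a ≠ b) (hac : a ≠ c) (hbc : b ≠ c)
    (hza : H.Adj z a) (hzb : H.Adj z b) (hzc : H.Adj z c)
    (hH : ∀ v w, H.Adj v w → v = z ∨ w = z) (hverts : H.verts = {z, a, b, c}) : H.IsClaw := by
  let f : Fin 1 ⊕ Fin 3 → H.verts := Sum.elim (fun _ => ⟨z, H.edge_vert hza⟩)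
    ![⟨a, H.edge_vert hza.symm⟩, ⟨b, H.edge_vert hzb.symm⟩, ⟨c, H.edge_vert hzc.symm⟩]
  have hf : Function.Bijective f := by
    constructor
    · intro i j hij
      have hij' : (f i).1 = (f j).1 := congrArg Subtype.val hij
      rcases i with i | i <;> rcases j with j | j <;> fin_cases i <;> fin_cases j <;>
        first
        | rfl
        | exact absurd hij' hza.ne
        | exact absurd hij' hzb.ne
        | exact absurd hij' hzc.ne
        | exact absurd hij' hab
        | exact absurd hij' hac
        | exact absurd hij' hbc
        | exact absurd hij'.symm hza.ne
        | exact absurd hij'.symm hzb.ne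
        | exact absurd hij'.symm hzc.ne
        | exact absurd hij'.symm hab
        | exact absurd hij'.symm hac
        | exact absurd hij'.symm hbc
    · rintro ⟨w, hw⟩
      have hw' := hw
      rw [hverts] at hw'
      rcases hw' with rfl | rfl | rfl | rfl
      · exact ⟨Sum.inl 0, rfl⟩
      · exact ⟨Sum.inr 0, rfl⟩
      · exact ⟨Sum.inr 1, rfl⟩
      · exact ⟨Sum.inr 2, rfl⟩
  have hno : ∀ v w, v ≠ z → w ≠ z → ¬ H.Adj v w := fun v w hv hw h1 => (hH v w h1).elim hv hw
  have hirr : ∀ v, ¬ H.Adj v v := fun v h => h.ne rfl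
  have ha := hza.ne.symm
  have hb := hzb.ne.symm
  have hc := hzc.ne.symm
  refine ⟨RelIso.symm ⟨Equiv.ofBijective f hf, ?_⟩⟩
  intro i j
  change H.Adj (f i).1 (f j).1 ↔ _
  rcases i with i | i <;> rcases j with j | j <;> fin_cases i <;> fin_cases j <;>
    simp [f, completeBipartiteGraph, hza, hzb, hzc, hza.symm, hzb.symm, hzc.symm, hirr, hno, ha, hb, hc]

/-- Two distinct edges of a triangle share an end; the vertices are named so that this end is `z`.
-/
theorem IsTriangle.exists_of_edges {T : G.Subgraph} (hT : T.IsTriangle) {e₁ e₂ : Sym2 V}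
    (hne : e₁ ≠ e₂) (h₁ : e₁ ∈ T.edgeSet) (h₂ : e₂ ∈ T.edgeSet) :
    ∃ x y z, T.Adj x y ∧ T.Adj x z ∧ T.Adj y z ∧ T.verts = {x, y, z} ∧ e₁ = s(x, z) ∧
      e₂ = s(y, z) := by
  obtain ⟨p, r, t, hpr, hpt, hrt, hverts⟩ := hT.exists_verts_eq
  have hedge : ∀ e ∈ T.edgeSet, e = s(p, r) ∨ e = s(p, t) ∨ e = s(r, t) := by
    intro e
    induction e using Sym2.ind with
    | _ v w =>
    intro he
    have hvw : T.Adj v w := he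
    have hv : v ∈ ({p, r, t} : Set V) := hverts ▸ T.edge_vert hvw
    have hw : w ∈ ({p, r, t} : Set V) := hverts ▸ T.edge_vert hvw.symm
    rcases hv with rfl | rfl | rfl <;> rcases hw with rfl | rfl | rfl <;>
      first
      | exact absurd rfl hvw.ne
      | simp [Sym2.eq_swap]
  have hperm : ∀ x y z : V, ({x, y, z} : Set V) = {p, r, t} → T.verts = {x, y, z} :=
    fun x y z h => hverts.trans h.symm
  rcases hedge _ h₁ with rfl | rfl | rfl <;> rcases hedge _ h₂ with rfl | rfl | rfl
  · exact absurd rfl hne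
  · exact ⟨r, t, p, hrt, hpr.symm, hpt.symm, hperm _ _ _ (by ext; simp; tauto), Sym2.eq_swap, Sym2.eq_swap⟩
  · exact ⟨p, t, r, hpt, hpr, hrt.symm, hperm _ _ _ (by ext; simp; tauto), rfl, Sym2.eq_swap⟩
  · exact ⟨t, r, p, hrt.symm, hpt.symm, hpr.symm, hperm _ _ _ (by ext; simp; tauto), Sym2.eq_swap, Sym2.eq_swap⟩
  · exact absurd rfl hne
  · exact ⟨p, r, t, hpr, hpt, hrt, hverts, rfl, rfl⟩
  · exact ⟨t, p, r, hpt.symm, hrt.symm, hpr, hperm _ _ _ (by ext; simp; tauto), Sym2.eq_swap, rfl⟩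
  · exact ⟨r, p, t, hpr.symm, hrt, hpt, hperm _ _ _ (by ext; simp; tauto), rfl, rfl⟩
  · exact absurd rfl hne

end Subgraph

theorem edgeInduced_adj {E : Set (Sym2 V)} (hE : E ⊆ G.edgeSet) {v w : V} :
    (G.edgeInduced E).Adj v w ↔ s(v, w) ∈ E := ⟨fun h => h.2, fun h => ⟨hE h, h⟩⟩

/-- Two edges `xz` and `yz` and an edge `ab` disjoint from them induce two components. -/
theorem hasTwoComponents_of_eq {x y z a b : V} (hxz : G.Adj x z) (hyz : G.Adj y z)
    (hab : G.Adj a b) (hxy : x ≠ y) (ha : a ∉ ({x, y, z} : Set V)) (hb : b ∉ ({x, y, z} : Set V)) :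
    G.HasTwoComponents {s(x, z), s(y, z), s(a, b)} (G.subgraphOfAdj hxz ⊔ G.subgraphOfAdj hyz)
      (G.subgraphOfAdj hab) := by
  have hH : G.edgeInduced {s(x, z), s(y, z), s(a, b)} =
      (G.subgraphOfAdj hxz ⊔ G.subgraphOfAdj hyz) ⊔ G.subgraphOfAdj hab := by
    have hadj : (G.edgeInduced {s(x, z), s(y, z), s(a, b)}).Adj =
        ((G.subgraphOfAdj hxz ⊔ G.subgraphOfAdj hyz) ⊔ G.subgraphOfAdj hab).Adj := by
      ext v w
      have hE : ({s(x, z), s(y, z), s(a, b)} : Set (Sym2 V)) ⊆ G.edgeSet := by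
        rintro e (rfl | rfl | rfl)
        · exact hxz
        · exact hyz
        · exact hab
      rw [edgeInduced_adj hE]
      simp only [Subgraph.sup_adj, subgraphOfAdj_adj, Set.mem_insert_iff, Set.mem_singleton_iff]
      rw [or_assoc, eq_comm, eq_comm (b := s(y, z)), eq_comm (b := s(a, b))]
    refine Subgraph.ext ?_ hadj
    ext v
    constructor
    · rintro ⟨w, hw⟩
      have hw' : (G.edgeInduced {s(x, z), s(y, z), s(a, b)}).Adj v w := hw
      rw [hadj] at hw'
      exact Subgraph.edge_vert _ hw'
    · simp only [Subgraph.verts_sup, subgraphOfAdj_verts, Set.mem_union, Set.mem_insert_iff,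
        Set.mem_singleton_iff]
      rintro (((rfl | rfl) | (rfl | rfl)) | (rfl | rfl))
      · exact ⟨z, hxz, by simp⟩
      · exact ⟨x, hxz.symm, by simp [Sym2.eq_swap]⟩
      · exact ⟨z, hyz, by simp⟩
      · exact ⟨y, hyz.symm, by simp [Sym2.eq_swap]⟩
      · exact ⟨b, hab, by simp⟩
      · exact ⟨a, hab.symm, by simp [Sym2.eq_swap]⟩
  refine ⟨?_, ?_, ?_⟩
  · rw [hH]
    refine Subgraph.components_sup ?_ (Subgraph.subgraphOfAdj_connected hab) ?_
    · exact Subgraph.connected_sup (Subgraph.subgraphOfAdj_connected hxz).preconnected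
        (Subgraph.subgraphOfAdj_connected hyz).preconnected ⟨z, by simp⟩
    · rw [Set.disjoint_right]
      simp only [Set.mem_insert_iff, Set.mem_singleton_iff] at ha hb
      simp only [Subgraph.verts_sup, subgraphOfAdj_verts, Set.mem_union, Set.mem_insert_iff,
        Set.mem_singleton_iff]
      rintro v (rfl | rfl) <;> tauto
  · rw [Subgraph.edgeSet_sup, edgeSet_subgraphOfAdj, edgeSet_subgraphOfAdj]
    refine Set.ncard_eq_two.2 ⟨_, _, ?_, rfl⟩
    intro h1
    rcases Sym2.eq_iff.1 h1 with ⟨h1, -⟩ | ⟨h1, -⟩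
    · exact hxy h1
    · exact hxz.ne h1
  · rw [edgeSet_subgraphOfAdj, Set.ncard_singleton]

/-- Puts an abstract two-component configuration into coordinates. The two edges of `H₂` already
cover the vertices of `T`, so the disjoint edge `ab` avoids the whole triangle. -/
theorem HasTwoComponents.exists_eq {E : Set (Sym2 V)} (hcard : E.ncard = 3)
    {H₂ H₁ T : G.Subgraph} (h : G.HasTwoComponents E H₂ H₁) (hT : T.IsTriangle) (hle : H₂ ≤ T) :
    ∃ x y z a b, T.Adj x y ∧ T.Adj x z ∧ T.Adj y z ∧ T.verts = {x, y, z} ∧ H₂.Adj x z ∧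
      H₂.Adj y z ∧ H₂.edgeSet = {s(x, z), s(y, z)} ∧ H₁.Adj a b ∧ H₁.verts = {a, b} ∧
      a ∉ T.verts ∧ b ∉ T.verts ∧ E = {s(x, z), s(y, z), s(a, b)} := by
  obtain ⟨hcomp, h2, h1⟩ := h
  have hH₂ : H₂ ∈ (G.edgeInduced E).components := hcomp ▸ Or.inl rfl
  have hH₁ : H₁ ∈ (G.edgeInduced E).components := hcomp ▸ Or.inr rfl
  have hd := Subgraph.disjoint_of_mem_components hH₂ hH₁ (by rintro rfl; omega)
  obtain ⟨e₁, e₂, hne, he⟩ := Set.ncard_eq_two.1 h2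
  obtain ⟨e, he₁⟩ := Set.ncard_eq_one.1 h1
  have hm₁ : e₁ ∈ H₂.edgeSet := he ▸ Or.inl rfl
  have hm₂ : e₂ ∈ H₂.edgeSet := he ▸ Or.inr rfl
  have hm : e ∈ H₁.edgeSet := he₁ ▸ rfl
  obtain ⟨x, y, z, hxy, hxz, hyz, hverts, rfl, rfl⟩ := hT.exists_of_edges hne
    (Subgraph.edgeSet_mono hle hm₁) (Subgraph.edgeSet_mono hle hm₂)
  induction e using Sym2.ind with
  | _ a b =>
  have hxz' : H₂.Adj x z := hm₁
  have hyz' : H₂.Adj y z := hm₂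
  have hab : H₁.Adj a b := hm
  have hTsub : T.verts ⊆ H₂.verts := by
    rw [hverts]
    rintro v (rfl | rfl | rfl)
    · exact H₂.edge_vert hxz'
    · exact H₂.edge_vert hyz'
    · exact H₂.edge_vert hyz'.symm
  have haT : a ∉ T.verts := fun h3 => Set.disjoint_left.1 hd (hTsub h3) (H₁.edge_vert hab)
  have hbT : b ∉ T.verts := fun h3 => Set.disjoint_left.1 hd (hTsub h3) (H₁.edge_vert hab.symm)
  refine ⟨x, y, z, a, b, hxy, hxz, hyz, hverts, hxz', hyz', he, hab, ?_, haT, hbT, ?_⟩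
  · apply subset_antisymm
    · refine hH₁.1.2.verts_subset_of_closed ?_ (H₁.edge_vert hab) (by simp)
      intro u w huw _
      have h3 : s(u, w) ∈ H₁.edgeSet := huw
      rw [he₁] at h3
      rcases Sym2.eq_iff.1 h3 with ⟨rfl, rfl⟩ | ⟨rfl, rfl⟩ <;> simp
    · rintro v (rfl | rfl)
      · exact H₁.edge_vert hab
      · exact H₁.edge_vert hab.symm
  · symm
    apply Set.eq_of_subset_of_ncard_le _ _ (Set.finite_of_ncard_pos (by omega))
    · rintro e (rfl | rfl | rfl)
      · exact (hH₂.1.1.2 hxz').2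
      · exact (hH₂.1.1.2 hyz').2
      · exact (hH₁.1.1.2 hab).2
    · rw [hcard, Set.ncard_eq_three.2 ⟨_, _, _, hne, ?_, ?_, rfl⟩]
      · intro h3
        rw [hverts] at haT
        rcases Sym2.eq_iff.1 h3 with ⟨rfl, rfl⟩ | ⟨rfl, rfl⟩ <;> simp at haT
      · intro h3
        rw [hverts] at haT
        rcases Sym2.eq_iff.1 h3 with ⟨rfl, rfl⟩ | ⟨rfl, rfl⟩ <;> simp at haT

/-! ### The triangle structure of a Δ-graph -/

theorem IsRegularOfDegree.exists_neighborSet_eq [G.LocallyFinite] (h : G.IsRegularOfDegree 3)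
    (v : V) : ∃ a b c, a ≠ b ∧ a ≠ c ∧ b ≠ c ∧ G.neighborSet v = {a, b, c} := by
  classical
  obtain ⟨a, b, c, hab, hac, hbc, h1⟩ := Finset.card_eq_three.1 (h v)
  refine ⟨a, b, c, hab, hac, hbc, ?_⟩
  rw [← coe_neighborFinset, h1]
  simp

/-- The class `q v` is the unique triangle at `v`. It uses two of the three neighbours of `v`, and
the remaining one is `m v`. -/
theorem IsDeltaGraph.exists_triangleStructure [G.LocallyFinite] (hG : G.IsDeltaGraph) :
    ∃ (q : V → G.Subgraph) (m : V → V), G.TriangleStructure q m := by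
  obtain ⟨hreg, htri⟩ := hG
  choose q hq huniq using htri
  have hq_iff : ∀ v w, q w = q v ↔ w ∈ (q v).verts :=
    fun v w => ⟨fun h => h ▸ (hq w).2, fun h => (huniq w _ ⟨(hq v).1, h⟩).symm⟩
  have hclass : ∀ v, {w | q w = q v} = (q v).verts := fun v => Set.ext fun w => hq_iff v w
  have hcard : ∀ v, {w | q w = q v}.ncard = 3 := fun v => by
    rw [hclass]
    exact (hq v).1.ncard_verts
  have hm : ∀ v, ∃ u, q u ≠ q v ∧ ∀ w, G.Adj v w ↔ (v ≠ w ∧ q v = q w) ∨ w = u := by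
    intro v
    have h2 : ({w | q w = q v} \ {v}).ncard = 2 := by
      rw [Set.ncard_sdiff_singleton_of_mem (show v ∈ {w | q w = q v} from rfl), hcard]
    have hN : (G.neighborSet v).ncard = 3 := by
      obtain ⟨a, b, c, hab, hac, hbc, h1⟩ := hreg.exists_neighborSet_eq v
      exact Set.ncard_eq_three.2 ⟨a, b, c, hab, hac, hbc, h1⟩
    have hfin : (G.neighborSet v).Finite := Set.finite_of_ncard_pos (by omega)
    have hsub : {w | q w = q v} \ {v} ⊆ G.neighborSet v := by
      rintro w ⟨hw, hwv⟩
      exact ((hq v).1.adj (hq v).2 ((hq_iff v w).1 hw) (Ne.symm hwv)).adj_sub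
    have h1 : (G.neighborSet v \ ({w | q w = q v} \ {v})).ncard = 1 := by
      rw [Set.ncard_sdiff hsub (hfin.subset hsub), hN, h2]
    obtain ⟨u, hu⟩ := Set.ncard_eq_one.1 h1
    have hu' : u ∈ G.neighborSet v \ ({w | q w = q v} \ {v}) := hu ▸ rfl
    have hvu : G.Adj v u := hu'.1
    refine ⟨u, fun h3 => hu'.2 ⟨h3, hvu.ne.symm⟩, ?_⟩
    intro w
    constructor
    · intro hvw
      by_cases hw : q w = q v
      · exact Or.inl ⟨hvw.ne, hw.symm⟩
      · right
        have : w ∈ G.neighborSet v \ ({w | q w = q v} \ {v}) := ⟨hvw, fun h3 => hw h3.1⟩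
        rw [hu] at this
        exact this
    · rintro (⟨hne, h3⟩ | rfl)
      · exact hsub ⟨h3.symm, Ne.symm hne⟩
      · exact hvu
  choose m hmq hadj using hm
  refine ⟨q, m, hadj, ?_, hmq, hcard⟩
  intro v
  have h1 : G.Adj (m v) v := ((hadj v (m v)).2 (Or.inr rfl)).symm
  rcases (hadj _ _).1 h1 with ⟨-, h2⟩ | h2
  · exact absurd h2 (hmq v)
  · exact h2.symm

/-! ### Translation between coordinates and the four configurations -/

namespace TriangleStructure

variable {Q : Type*} {q : V → Q} {m : V → V}

theorem q_eq_of_adj (h : G.TriangleStructure q m) {x y z : V} (hxy : G.Adj x y) (hxz : G.Adj x z)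
    (hyz : G.Adj y z) : q x = q y := by
  rcases (h.adj_iff _ _).1 hxy with h1 | rfl
  · exact h1.2
  · rcases (h.adj_iff _ _).1 hxz with h1 | h1
    · rcases (h.adj_iff _ _).1 hyz with h2 | h2
      · exact h1.2.trans h2.2.symm
      · rw [h.inv] at h2
        exact absurd h2.symm hxz.ne
    · exact absurd h1.symm hyz.ne

theorem q_eq_of_isTriangle (h : G.TriangleStructure q m) {T : G.Subgraph} (hT : T.IsTriangle)
    {v w : V} (hv : v ∈ T.verts) (hw : w ∈ T.verts) : q v = q w := by
  obtain ⟨x, y, z, hxy, hxz, hyz, hverts⟩ := hT.exists_verts_eq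
  have h1 := h.q_eq_of_adj hxy.adj_sub hxz.adj_sub hyz.adj_sub
  have h2 := h.q_eq_of_adj hxz.adj_sub hxy.adj_sub hyz.adj_sub.symm
  have key : ∀ u ∈ T.verts, q u = q x := by
    rw [hverts]
    rintro u (rfl | rfl | rfl)
    · rfl
    · exact h1.symm
    · exact h2.symm
  rw [key v hv, key w hw]

/-- The triangle of `G` spanned by the class of `z`. -/
theorem exists_isTriangle (h : G.TriangleStructure q m) (z : V) :
    ∃ T : G.Subgraph, T.IsTriangle ∧ T.verts = {w | q w = q z} ∧
      ∀ v w, T.Adj v w ↔ q v = q z ∧ q w = q z ∧ v ≠ w := by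
  obtain ⟨x, y, hxy, hxz, hyz, hx, hy⟩ := h.exists_others z
  let T : G.Subgraph :=
    { verts := {w | q w = q z}
      Adj := fun v w => q v = q z ∧ q w = q z ∧ v ≠ w
      adj_sub := fun h1 => h.adj_of_q h1.2.2 (h1.1.trans h1.2.1.symm)
      edge_vert := fun h1 => h1.1
      symm := ⟨fun _ _ h1 => ⟨h1.2.1, h1.1, h1.2.2.symm⟩⟩ }
  exact ⟨T, Subgraph.isTriangle_of_verts_eq (x := x) (y := y) (z := z) ⟨hx, hy, hxy⟩ ⟨hx, rfl, hxz⟩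
    ⟨hy, rfl, hyz⟩ (h.class_eq hxy hxz hyz hx hy), rfl, fun _ _ => Iff.rfl⟩

/-- Some triangle has a deleted edge at each of its vertices; this takes two deleted edges, whose
common end is called `z`. -/
theorem exists_bad_class (h : G.TriangleStructure q m) {E : Set (Sym2 V)}
    (hno : ¬ (G.deleteEdges E).HasLambdaFactor) :
    ∃ x y z, x ≠ y ∧ x ≠ z ∧ y ≠ z ∧ q x = q z ∧ q y = q z ∧ s(x, z) ∈ E ∧ s(y, z) ∈ E := by
  have h1 : ∃ v, ∀ b, q b = q v → ∃ y, q y = q v ∧ y ≠ b ∧ s(b, y) ∈ E := by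
    by_contra! hcon
    exact hno (h.hasLambdaFactor_of_forall_exists_center hcon)
  obtain ⟨v, hv⟩ := h1
  obtain ⟨w, hw, hwv, hE⟩ := hv v rfl
  obtain ⟨u, huv, huw, hu⟩ := h.exists_third v w
  have huv' : q u = q v := hu.trans hw
  obtain ⟨t, ht, htu, htE⟩ := hv u huv'
  rcases h.eq_of_class huw huv hwv huv' hw ht with rfl | rfl | rfl
  · exact absurd rfl htu
  · exact ⟨v, u, t, huv.symm, hwv.symm, huw, hw.symm, hu, hE, htE⟩
  · exact ⟨w, u, t, huw.symm, hwv, huv, hw, huv', Sym2.eq_swap ▸ hE, htE⟩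

theorem not_hasLambdaFactor_of_isClaw (h : G.TriangleStructure q m) {E : Set (Sym2 V)}
    (hC : (G.edgeInduced E).IsClaw) : ¬ (G.deleteEdges E).HasLambdaFactor := by
  obtain ⟨z, a, b, c, hab, hac, hbc, ha, hb, hc⟩ := hC.exists_adj
  obtain ⟨x, y, hxy, hxz, hyz, hx, hy⟩ := h.exists_others z
  have hmem : ∀ w, G.Adj z w → w ∈ ({x, y, m z} : Set V) := by
    intro w hw
    rcases (h.adj_iff _ _).1 hw with ⟨hne, hq⟩ | rfl
    · rcases h.eq_of_class hxy hxz hyz hx hy hq.symm with rfl | rfl | rfl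
      · simp
      · simp
      · exact absurd rfl hne
    · simp
  have hset : ({a, b, c} : Set V) = {x, y, m z} := by
    apply Set.eq_of_subset_of_ncard_le _ _ (Set.toFinite _)
    · rintro w (rfl | rfl | rfl)
      · exact hmem _ ha.1
      · exact hmem _ hb.1
      · exact hmem _ hc.1
    · rw [Set.ncard_eq_three.2 ⟨a, b, c, hab, hac, hbc, rfl⟩]
      exact Set.ncard_insert_le _ _ |>.trans (by
        have := Set.ncard_insert_le y ({m z} : Set V)
        rw [Set.ncard_singleton] at this
        omega)
  refine not_hasLambdaFactor_of_isolated (z := z) fun w hw => ?_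
  rw [deleteEdges_adj] at hw
  have hw' := hmem w hw.1
  rw [← hset] at hw'
  rcases hw' with rfl | rfl | rfl
  · exact hw.2 ha.2
  · exact hw.2 hb.2
  · exact hw.2 hc.2

theorem not_hasLambdaFactor_of_edgeInduced_isTriangle [Fintype V] (h : G.TriangleStructure q m)
    {E : Set (Sym2 V)} (hT : (G.edgeInduced E).IsTriangle) :
    ¬ (G.deleteEdges E).HasLambdaFactor := by
  obtain ⟨x, y, z, hxy, hxz, hyz, hverts⟩ := hT.exists_verts_eq
  have hx : q x = q z := h.q_eq_of_adj hxz.1 hxy.1 hyz.1.symm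
  have hy : q y = q z := h.q_eq_of_adj hyz.1 hxy.1.symm hxz.1.symm
  refine h.not_hasLambdaFactor_of_triangle (z := z) fun v w hne hv hw => ?_
  refine (hT.adj ?_ ?_ hne).2
  · rw [hverts]
    exact h.eq_of_class hxy.ne hxz.ne hyz.ne hx hy hv
  · rw [hverts]
    exact h.eq_of_class hxy.ne hxz.ne hyz.ne hx hy hw

theorem not_hasLambdaFactor_of_configE3 [Fintype V] (h : G.TriangleStructure q m)
    (h2 : G.IsKConnected 2) {E : Set (Sym2 V)} (hcard : E.ncard = 3) (hC : G.ConfigE3 E) :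
    ¬ (G.deleteEdges E).HasLambdaFactor := by
  obtain ⟨H₂, H₁, hcomp, ⟨T, hT, hle⟩, hD, hconn⟩ := hC
  obtain ⟨x, y, z, a, b, hxy, hxz, hyz, hverts, -, -, -, hab, hH₁, haT, -, hEeq⟩ :=
    hcomp.exists_eq hcard hT hle
  have hz : z ∈ T.verts := T.edge_vert hyz.symm
  have hx := h.q_eq_of_isTriangle hT (T.edge_vert hxz) hz
  have hy := h.q_eq_of_isTriangle hT (T.edge_vert hyz) hz
  -- If `a` and `b` were in the same class, the edge `ab` would lie in the triangle spanned by that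
  -- class.
  have hbm : b = m a := by
    rcases (h.adj_iff _ _).1 hab.adj_sub with ⟨hne, hq⟩ | h1
    · exfalso
      obtain ⟨D, hDT, hDverts, hDadj⟩ := h.exists_isTriangle b
      refine hD ⟨D, hDT, ?_, ?_⟩
      · rw [hDverts, hH₁]
        rintro v (rfl | rfl)
        · exact hq
        · rfl
      · intro v w hvw
        have hv := H₁.edge_vert hvw
        have hw := H₁.edge_vert hvw.symm
        rw [hH₁] at hv hw
        refine (hDadj _ _).2 ⟨?_, ?_, hvw.ne⟩
        · rcases hv with rfl | rfl
          · exact hq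
          · rfl
        · rcases hw with rfl | rfl
          · exact hq
          · rfl
    · exact h1
  subst hbm
  refine h.not_hasLambdaFactor_of_not_connected h2 hxy.ne hxz.ne hyz.ne hx hy ?_ hEeq hconn
  intro hq
  apply haT
  rw [hverts]
  exact h.eq_of_class hxy.ne hxz.ne hyz.ne hx hy hq

theorem eq_m_edge_of_notMem (h : G.TriangleStructure q m) {D : G.Subgraph} (hD : D.IsTriangle)
    {v : V} (hv : v ∈ D.verts) {e : Sym2 V} (he : e ∈ G.edgeSet) (heD : e ∉ D.edgeSet)
    (hve : v ∈ e) : e = s(v, m v) := by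
  obtain ⟨w, rfl⟩ := hve
  rcases (h.adj_iff _ _).1 he with ⟨hne, hq⟩ | h1
  · exfalso
    obtain ⟨x, y, z, hxy, hxz, hyz, hverts⟩ := hD.exists_verts_eq
    have hz : z ∈ D.verts := D.edge_vert hyz.symm
    have hx := h.q_eq_of_isTriangle hD (D.edge_vert hxz) hz
    have hy := h.q_eq_of_isTriangle hD (D.edge_vert hyz) hz
    have hw : w ∈ D.verts := by
      rw [hverts]
      exact h.eq_of_class hxy.ne hxz.ne hyz.ne hx hy
        (hq.symm.trans (h.q_eq_of_isTriangle hD hv hz))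
    exact heD (hD.adj hv hw hne)
  · exact congrArg (fun u => s(v, u)) h1

theorem not_hasLambdaFactor_of_configE4 [Fintype V] (h : G.TriangleStructure q m)
    (h2 : G.IsKConnected 2) {E : Set (Sym2 V)} (hcard : E.ncard = 3) (hC : G.ConfigE4 E) :
    ¬ (G.deleteEdges E).HasLambdaFactor := by
  obtain ⟨H₂, H₁, T, D, hcomp, hT, hle, hD, hleD, c, t₁, d, t, ⟨hcD, hcH₁⟩, ⟨htT, htiso⟩,
    ⟨⟨hdG, hdDT⟩, hcd⟩, ⟨⟨htG, htDT⟩, ht₁t⟩, C₁, C₂, hne, hC₁, hC₂⟩ := hC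
  obtain ⟨x, y, z, a, b, hxy, hxz, hyz, hverts, hHxz, hHyz, hH₂, hab, hH₁, haT, -, hEeq⟩ :=
    hcomp.exists_eq hcard hT hle
  have hz : z ∈ T.verts := T.edge_vert hyz.symm
  have hx := h.q_eq_of_isTriangle hT (T.edge_vert hxz) hz
  have hy := h.q_eq_of_isTriangle hT (T.edge_vert hyz) hz
  -- The edge `xy` of `T` survives, so `x` and `y` are not isolated.
  have ht₁z : t₁ = z := by
    have hxyH : s(x, y) ∉ H₂.edgeSet := by
      rw [hH₂]
      simp [hxz.ne, hyz.ne, hxy.ne]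
    rw [hverts] at htT
    rcases htT with rfl | rfl | rfl
    · exact absurd ((Subgraph.deleteEdges_adj _ _ _).2 ⟨hxy, hxyH⟩) (htiso y)
    · exact absurd ((Subgraph.deleteEdges_adj _ _ _).2 ⟨hxy.symm, Sym2.eq_swap ▸ hxyH⟩) (htiso x)
    · rfl
  subst ht₁z
  have haH := H₁.edge_vert hab
  have hbH := H₁.edge_vert hab.symm
  have hac : a ≠ c := fun e => hcH₁ (e ▸ haH)
  have hbc : b ≠ c := fun e => hcH₁ (e ▸ hbH)
  have ha := h.q_eq_of_isTriangle hD (hleD.1 haH) hcD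
  have hb := h.q_eq_of_isTriangle hD (hleD.1 hbH) hcD
  have hd := h.eq_m_edge_of_notMem hD hcD hdG (fun h1 => hdDT (Or.inl h1)) hcd
  have ht := h.eq_m_edge_of_notMem hT hz htG (fun h1 => htDT (Or.inr h1)) ht₁t
  subst hd ht
  refine h.not_hasLambdaFactor_of_not_reachable h2 hxy.ne hxz.ne hyz.ne hx hy hab.ne hac hbc ha hb
    (by rw [hEeq]; simp) (by rw [hEeq]; simp) (by rw [hEeq]; simp) ?_
  intro hreach
  have h3 := hC₁ haH
  have h4 := hC₂ (H₂.edge_vert hHxz)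
  rw [ConnectedComponent.mem_supp_iff] at h3 h4
  exact hne (by rw [← h3, ← h4, ConnectedComponent.eq]; exact hreach)

theorem configE3_of_not_connected (h : G.TriangleStructure q m) {x y z u : V} (hxy : x ≠ y)
    (hxz : x ≠ z) (hyz : y ≠ z) (hx : q x = q z) (hy : q y = q z) (hu : q u ≠ q z)
    (hmu : q (m u) ≠ q z) {E : Set (Sym2 V)} (hE : E = {s(x, z), s(y, z), s(u, m u)})
    (hconn : ¬ (G.deleteEdges E).Connected) : G.ConfigE3 E := by
  have hnot : ∀ v, q v ≠ q z → v ∉ ({x, y, z} : Set V) := by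
    rintro v hv (rfl | rfl | rfl)
    · exact hv hx
    · exact hv hy
    · exact hv rfl
  have hGxz := h.adj_of_q hxz hx
  have hGyz := h.adj_of_q hyz hy
  refine ⟨_, _, hE ▸ hasTwoComponents_of_eq hGxz hGyz (h.adj_m u) hxy (hnot _ hu) (hnot _ hmu), ?_,
    ?_, hconn⟩
  · obtain ⟨T, hT, -, hTadj⟩ := h.exists_isTriangle z
    refine ⟨T, hT, sup_le ?_ ?_⟩
    · exact subgraphOfAdj_le_of_adj T ((hTadj _ _).2 ⟨hx, rfl, hxz⟩)
    · exact subgraphOfAdj_le_of_adj T ((hTadj _ _).2 ⟨hy, rfl, hyz⟩)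
  · rintro ⟨D, hD, hle⟩
    have h1 : D.Adj u (m u) := (subgraphOfAdj_le_iff (h.adj_m u) D).1 hle
    exact h.ne u (h.q_eq_of_isTriangle hD (D.edge_vert h1.symm) (D.edge_vert h1))

theorem configE4_of_not_reachable (h : G.TriangleStructure q m) {x y z a b c : V} (hxy : x ≠ y)
    (hxz : x ≠ z) (hyz : y ≠ z) (hx : q x = q z) (hy : q y = q z) (hab : a ≠ b) (hac : a ≠ c)
    (hbc : b ≠ c) (ha : q a = q c) (hb : q b = q c) (hcz : q c ≠ q z) {E : Set (Sym2 V)}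
    (hE : E = {s(x, z), s(y, z), s(a, b)})
    (hreach : ¬ (G.deleteEdges {s(c, m c), s(z, m z)}).Reachable a x) : G.ConfigE4 E := by
  have hnot : ∀ v, q v ≠ q z → v ∉ ({x, y, z} : Set V) := by
    rintro v hv (rfl | rfl | rfl)
    · exact hv hx
    · exact hv hy
    · exact hv rfl
  have hGxz := h.adj_of_q hxz hx
  have hGyz := h.adj_of_q hyz hy
  have hGab := h.adj_of_q hab (ha.trans hb.symm)
  obtain ⟨T, hT, hTv, hTadj⟩ := h.exists_isTriangle z
  obtain ⟨D, hD, hDv, hDadj⟩ := h.exists_isTriangle c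
  have hout : ∀ v, s(v, m v) ∈ G.edgeSet \ (D.edgeSet ∪ T.edgeSet) := by
    intro v
    refine ⟨h.adj_m v, ?_⟩
    rintro (h1 | h1)
    · have h3 := (hDadj _ _).1 h1
      exact h.ne v (h3.2.1.trans h3.1.symm)
    · have h3 := (hTadj _ _).1 h1
      exact h.ne v (h3.2.1.trans h3.1.symm)
  have hadj : ∀ v w, v ≠ w → q v = q w → (G.deleteEdges {s(c, m c), s(z, m z)}).Adj v w := by
    intro v w hne hvw
    rw [deleteEdges_adj]
    refine ⟨h.adj_of_q hne hvw, ?_⟩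
    rintro (h1 | h1) <;> rcases Sym2.eq_iff.1 h1 with ⟨rfl, rfl⟩ | ⟨rfl, rfl⟩
    · exact h.ne _ hvw.symm
    · exact h.ne _ hvw
    · exact h.ne _ hvw.symm
    · exact h.ne _ hvw
  refine ⟨_, _, T, D, hE ▸ hasTwoComponents_of_eq hGxz hGyz hGab hxy (hnot _ (ha ▸ hcz))
    (hnot _ (hb ▸ hcz)), hT, ?_, hD, ?_, c, z, s(c, m c), s(z, m z), ⟨?_, ?_⟩, ⟨?_, ?_⟩,
    ⟨hout c, by simp⟩, ⟨hout z, by simp⟩, connectedComponentMk _ a, connectedComponentMk _ x, ?_, ?_,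
    ?_⟩
  · refine sup_le ?_ ?_
    · exact subgraphOfAdj_le_of_adj T ((hTadj _ _).2 ⟨hx, rfl, hxz⟩)
    · exact subgraphOfAdj_le_of_adj T ((hTadj _ _).2 ⟨hy, rfl, hyz⟩)
  · exact subgraphOfAdj_le_of_adj D ((hDadj _ _).2 ⟨ha, hb, hab⟩)
  · rw [hDv]
    rfl
  · simp [hac.symm, hbc.symm]
  · rw [hTv]
    rfl
  · intro w hw
    rw [Subgraph.deleteEdges_adj, hTadj, Subgraph.edgeSet_sup, edgeSet_subgraphOfAdj,
      edgeSet_subgraphOfAdj] at hw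
    obtain ⟨⟨-, hqw, hne⟩, hw⟩ := hw
    apply hw
    rcases h.eq_of_class hxy hxz hyz hx hy hqw with rfl | rfl | rfl
    · exact Or.inl Sym2.eq_swap
    · exact Or.inr Sym2.eq_swap
    · exact absurd rfl hne
  · intro h1
    exact hreach (ConnectedComponent.eq.1 h1)
  · rw [subgraphOfAdj_verts]
    rintro v (rfl | rfl)
    · rfl
    · exact ConnectedComponent.eq.2 (hadj _ _ hab.symm (hb.trans ha.symm)).reachable
  · rw [Subgraph.verts_sup, subgraphOfAdj_verts, subgraphOfAdj_verts]
    rintro v ((rfl | rfl) | (rfl | rfl))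
    · rfl
    · exact ConnectedComponent.eq.2 (hadj _ _ hxz.symm hx.symm).reachable
    · exact ConnectedComponent.eq.2 (hadj _ _ hxy.symm (hy.trans hx.symm)).reachable
    · exact ConnectedComponent.eq.2 (hadj _ _ hxz.symm hx.symm).reachable

theorem isClaw_of_eq (h : G.TriangleStructure q m) {x y z : V} (hxy : x ≠ y)
    (hxz : x ≠ z) (hyz : y ≠ z) (hx : q x = q z) (hy : q y = q z) {E : Set (Sym2 V)}
    (hEG : E ⊆ G.edgeSet) (hE : E = {s(x, z), s(y, z), s(z, m z)}) :
    (G.edgeInduced E).IsClaw := by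
  have hxm : x ≠ m z := fun e => h.ne z (by rw [← e, hx])
  have hym : y ≠ m z := fun e => h.ne z (by rw [← e, hy])
  have hzx : s(z, x) ∈ E := by rw [hE, Sym2.eq_swap]; simp
  have hzy : s(z, y) ∈ E := by rw [hE, Sym2.eq_swap]; simp
  have hzm : s(z, m z) ∈ E := by rw [hE]; simp
  have hadj : ∀ v w, s(v, w) ∈ E → (v = z ∧ w ∈ ({x, y, m z} : Set V)) ∨
      (w = z ∧ v ∈ ({x, y, m z} : Set V)) := by
    intro v w hvw
    rw [hE] at hvw
    rcases hvw with h1 | h1 | h1 <;> rcases Sym2.eq_iff.1 h1 with ⟨rfl, rfl⟩ | ⟨rfl, rfl⟩ <;> simp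
  refine Subgraph.isClaw_of_adj (z := z) hxy hxm hym ((edgeInduced_adj hEG).2 hzx)
    ((edgeInduced_adj hEG).2 hzy) ((edgeInduced_adj hEG).2 hzm) ?_ ?_
  · intro v w hvw
    rcases hadj v w hvw.2 with h1 | h1
    · exact Or.inl h1.1
    · exact Or.inr h1.1
  · ext v
    constructor
    · rintro ⟨w, -, hvw⟩
      rcases hadj v w hvw with ⟨h1, -⟩ | ⟨-, h1⟩
      · exact Or.inl h1
      · exact Or.inr h1
    · rintro (rfl | rfl | rfl | rfl)
      · exact ⟨x, hEG hzx, hzx⟩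
      · exact ⟨z, (hEG hzx).symm, Sym2.eq_swap ▸ hzx⟩
      · exact ⟨z, (hEG hzy).symm, Sym2.eq_swap ▸ hzy⟩
      · exact ⟨z, (hEG hzm).symm, Sym2.eq_swap ▸ hzm⟩

theorem isTriangle_of_eq {x y z : V} {E : Set (Sym2 V)}
    (hEG : E ⊆ G.edgeSet) (hE : E = {s(x, z), s(y, z), s(x, y)}) :
    (G.edgeInduced E).IsTriangle := by
  have hxz : (G.edgeInduced E).Adj x z := (edgeInduced_adj hEG).2 (by rw [hE]; simp)
  have hyz : (G.edgeInduced E).Adj y z := (edgeInduced_adj hEG).2 (by rw [hE]; simp)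
  have hxy : (G.edgeInduced E).Adj x y := (edgeInduced_adj hEG).2 (by rw [hE]; simp)
  refine Subgraph.isTriangle_of_verts_eq hxy hxz hyz ?_
  ext v
  constructor
  · rintro ⟨w, -, hvw⟩
    rw [hE] at hvw
    rcases hvw with h1 | h1 | h1 <;> rcases Sym2.eq_iff.1 h1 with ⟨rfl, rfl⟩ | ⟨rfl, rfl⟩ <;> simp
  · rintro (rfl | rfl | rfl)
    · exact ⟨_, hxy⟩
    · exact ⟨_, hyz⟩
    · exact ⟨_, hyz.symm⟩

/-- Two edges `xz`, `yz` are forced by `exists_bad_class`; the outcome depends on whether the third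
edge is a triangle edge or a matching edge and on whether it meets the triangle of `z`. -/
theorem config_of_not_hasLambdaFactor [Fintype V] (h : G.TriangleStructure q m)
    (h2 : G.IsKConnected 2) {E : Set (Sym2 V)} (hEG : E ⊆ G.edgeSet) (hcard : E.ncard = 3)
    (hno : ¬ (G.deleteEdges E).HasLambdaFactor) :
    (G.edgeInduced E).IsClaw ∨ (G.edgeInduced E).IsTriangle ∨ G.ConfigE3 E ∨ G.ConfigE4 E := by
  obtain ⟨x, y, z, hxy, hxz, hyz, hx, hy, hxE, hyE⟩ := h.exists_bad_class hno
  have hne : s(x, z) ≠ s(y, z) := by simp [hxy, hxz]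
  obtain ⟨e, heq⟩ : ∃ e, E = {s(x, z), s(y, z), e} := by
    have hfin : E.Finite := Set.finite_of_ncard_pos (by omega)
    have hsub : ({s(x, z), s(y, z)} : Set (Sym2 V)) ⊆ E := by
      rintro e (rfl | rfl)
      · exact hxE
      · exact hyE
    have h1 : (E \ {s(x, z), s(y, z)}).ncard = 1 := by
      rw [Set.ncard_sdiff hsub (hfin.subset hsub), hcard, Set.ncard_pair hne]
    obtain ⟨e, he⟩ := Set.ncard_eq_one.1 h1
    refine ⟨e, ?_⟩
    rw [← Set.union_sdiff_cancel hsub, he]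
    ext
    simp only [Set.mem_union, Set.mem_insert_iff, Set.mem_singleton_iff, or_assoc]
  have heE : e ∈ E := by rw [heq]; simp
  have heG := hEG heE
  have hexz : e ≠ s(x, z) := by
    rintro rfl
    rw [heq, Set.insert_eq_of_mem (by simp), Set.ncard_pair hne.symm] at hcard
    omega
  have heyz : e ≠ s(y, z) := by
    rintro rfl
    rw [heq, Set.insert_eq_of_mem (a := s(y, z)) (by simp), Set.ncard_pair hne] at hcard
    omega
  induction e using Sym2.ind with
  | _ a b =>
  rcases (h.adj_iff a b).1 heG with ⟨hab, hq⟩ | rfl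
  · by_cases haz : q a = q z
    · refine Or.inr (Or.inl (isTriangle_of_eq (x := x) (y := y) (z := z) hEG ?_))
      rw [heq]
      congr 3
      rcases h.eq_of_class hxy hxz hyz hx hy haz with rfl | rfl | rfl <;>
        rcases h.eq_of_class hxy hxz hyz hx hy (hq.symm.trans haz) with rfl | rfl | rfl <;>
        first
        | rfl
        | exact absurd rfl hab
        | exact Sym2.eq_swap
        | exact absurd rfl hexz
        | exact absurd rfl heyz
        | exact absurd Sym2.eq_swap hexz
        | exact absurd Sym2.eq_swap heyz
    · right; right; right
      obtain ⟨c, hca, hcb, hc⟩ := h.exists_third a b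
      have hcz : q c ≠ q z := by rwa [hc, ← hq]
      exact h.configE4_of_not_reachable hxy hxz hyz hx hy hab hca.symm hcb.symm (hq.trans hc.symm)
        hc.symm hcz heq (h.exists_cut_of_no_factor h2 hxy hxz hyz hx hy hab hca.symm hcb.symm
          (hq.trans hc.symm) hc.symm hcz heq hno)
  -- Stated for all `a` because either end of the matching edge may lie in the triangle. At `x` or
  -- `y` a factor exists, so only `z` remains.
  · have key : ∀ a, E = {s(x, z), s(y, z), s(a, m a)} → q a = q z → (G.edgeInduced E).IsClaw := by
      intro a heq haz
      rcases h.eq_of_class hxy hxz hyz hx hy haz with rfl | rfl | rfl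
      · exact absurd (h.hasLambdaFactor_of_path h2 hxy hxz hyz hx hy (by rw [heq]; simp)) hno
      · refine absurd (h.hasLambdaFactor_of_path h2 hxy.symm hyz hxz hy hx ?_) hno
        rw [heq]
        simp
      · exact h.isClaw_of_eq hxy hxz hyz hx hy hEG heq
    by_cases haz : q a = q z
    · exact Or.inl (key a heq haz)
    · by_cases hmaz : q (m a) = q z
      · exact Or.inl (key (m a) (by rw [heq, h.inv, Sym2.eq_swap (a := a)]) hmaz)
      · right; right; left
        exact h.configE3_of_not_connected hxy hxz hyz hx hy haz hmaz heq
          (h.not_connected_of_no_factor_ext hxy hxz hyz hx hy haz hmaz heq hno)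

theorem hasLambdaFactor_of_ncard_eq_two [Fintype V] (h : G.TriangleStructure q m)
    (h2 : G.IsKConnected 2) {E : Set (Sym2 V)} (hcard : E.ncard = 2) :
    (G.deleteEdges E).HasLambdaFactor := by
  by_contra hno
  obtain ⟨x, y, z, hxy, hxz, hyz, hx, hy, hxE, hyE⟩ := h.exists_bad_class hno
  have hne : s(x, z) ≠ s(y, z) := by simp [hxy, hxz]
  have hfin : E.Finite := Set.finite_of_ncard_pos (by omega)
  have heq : ({s(x, z), s(y, z)} : Set (Sym2 V)) = E := by
    apply Set.eq_of_subset_of_ncard_le _ _ hfin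
    · rintro e (rfl | rfl)
      · exact hxE
      · exact hyE
    · rw [hcard, Set.ncard_pair hne]
  exact hno (h.hasLambdaFactor_of_two h2 hxy hxz hyz hx hy (by rw [← heq]; simp))

end TriangleStructure

/-! ### The 3-connected claw-free case -/

theorem IsKConnected.mono [Fintype V] {k l : ℕ} (hG : G.IsKConnected l) (hkl : k ≤ l) :
    G.IsKConnected k :=
  ⟨hkl.trans_lt hG.1, fun S hS => hG.2 S (hS.trans_le hkl)⟩

theorem exists_isTriangle_of_adj {x y z : V} (hxy : G.Adj x y) (hxz : G.Adj x z)
    (hyz : G.Adj y z) : ∃ T : G.Subgraph, T.IsTriangle ∧ T.verts = {x, y, z} :=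
  ⟨(⊤ : G.Subgraph).induce {x, y, z}, Subgraph.isTriangle_of_verts_eq (x := x) (y := y) (z := z)
    (by simp [hxy]) (by simp [hxz]) (by simp [hyz]) rfl, rfl⟩

theorem IsClawFree.exists_adj (hG : G.IsClawFree) {v a b c : V} (hva : G.Adj v a)
    (hvb : G.Adj v b) (hvc : G.Adj v c) (hab : a ≠ b) (hac : a ≠ c) (hbc : b ≠ c) :
    G.Adj a b ∨ G.Adj a c ∨ G.Adj b c := by
  by_contra! hcon
  obtain ⟨nab, nac, nbc⟩ := hcon
  let f : Fin 1 ⊕ Fin 3 → V := Sum.elim (fun _ => v) ![a, b, c]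
  have hf : Function.Injective f := by
    intro i j hij
    rcases i with i | i <;> rcases j with j | j <;> fin_cases i <;> fin_cases j <;>
      first
      | rfl
      | exact absurd hij hva.ne
      | exact absurd hij hvb.ne
      | exact absurd hij hvc.ne
      | exact absurd hij hab
      | exact absurd hij hac
      | exact absurd hij hbc
      | exact absurd hij.symm hva.ne
      | exact absurd hij.symm hvb.ne
      | exact absurd hij.symm hvc.ne
      | exact absurd hij.symm hab
      | exact absurd hij.symm hac
      | exact absurd hij.symm hbc
  refine hG.false ⟨⟨f, hf⟩, ?_⟩
  intro i j
  change G.Adj (f i) (f j) ↔ _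
  rcases i with i | i <;> rcases j with j | j <;> fin_cases i <;> fin_cases j <;>
    simp [f, completeBipartiteGraph, hva, hvb, hvc, hva.symm, hvb.symm, hvc.symm, nab, nac, nbc,
      mt Adj.symm nab, mt Adj.symm nac, mt Adj.symm nbc]

/-- A 3-connected cubic graph with more than four vertices has no two triangles sharing an edge. -/
theorem IsKConnected.false_of_diamond [Fintype V] [G.LocallyFinite] (h3 : G.IsKConnected 3)
    (hreg : G.IsRegularOfDegree 3) (hcard : 6 ≤ Fintype.card V) {v a b c : V} (hva : G.Adj v a)
    (hvb : G.Adj v b) (hvc : G.Adj v c) (hab : G.Adj a b) (hac : G.Adj a c) (hbc : b ≠ c) :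
    False := by
  classical
  have hN : ∀ v a b c, G.Adj v a → G.Adj v b → G.Adj v c → a ≠ b → a ≠ c → b ≠ c → ∀ w, G.Adj v w →
      w = a ∨ w = b ∨ w = c := by
    intro v a b c hva hvb hvc hab hac hbc w hw
    have h1 : ({a, b, c} : Finset V) = G.neighborFinset v := by
      apply Finset.eq_of_subset_of_card_le
      · intro u hu
        rw [mem_neighborFinset]
        simp only [Finset.mem_insert, Finset.mem_singleton] at hu
        rcases hu with rfl | rfl | rfl <;> assumption
      · rw [Finset.card_eq_three.2 ⟨a, b, c, hab, hac, hbc, rfl⟩]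
        exact (hreg v).le
    have h2 : w ∈ ({a, b, c} : Finset V) := h1 ▸ (G.mem_neighborFinset v w).2 hw
    simpa using h2
  obtain ⟨w, hw⟩ : ∃ w, w ∉ ({v, a, b, c} : Finset V) := by
    by_contra! hall
    have h1 : Fintype.card V ≤ ({v, a, b, c} : Finset V).card := by
      rw [← Finset.card_univ]
      exact Finset.card_le_card fun x _ => hall x
    have h2 := Finset.card_le_four (a := v) (b := a) (c := b) (d := c)
    omega
  simp only [Finset.mem_insert, Finset.mem_singleton, not_or] at hw
  -- All neighbours of `v` and `a` lie in `{v, a, b, c}`, so removing `{b, c}` would separate them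
  -- from the fifth vertex `w`.
  obtain ⟨u, t, hut, hu, ht, huS, htS⟩ := h3.exists_crossing (S := {b, c})
    ((Finset.card_le_two).trans_lt (by norm_num)) (U := {v, a}) (a := v) (b := w) (by simp)
    (by simp [hvb.ne, hvc.ne]) (by simp [hw]) (by simp [hw])
  simp only [Finset.mem_insert, Finset.mem_singleton, Set.mem_insert_iff, Set.mem_singleton_iff,
    not_or] at hu ht huS htS
  rcases hu with rfl | rfl
  · rcases hN _ a b c hva hvb hvc hab.ne hac.ne hbc t hut with h1 | h1 | h1 <;> tauto
  · rcases hN _ v b c hva.symm hab hac hvb.ne hvc.ne hbc t hut with h1 | h1 | h1 <;> tauto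

/-- Claw-freeness makes two of the three neighbours of `v` adjacent. A second adjacent pair would
create two triangles sharing an edge, which `false_of_diamond` excludes. -/
theorem IsClawFree.isDeltaGraph [Fintype V] [G.LocallyFinite] (hG : G.IsClawFree)
    (h3 : G.IsKConnected 3) (hreg : G.IsRegularOfDegree 3) (hcard : 6 ≤ Fintype.card V) :
    G.IsDeltaGraph := by
  refine ⟨hreg, fun v => ?_⟩
  obtain ⟨a, b, c, hab, hac, hbc, hN⟩ := hreg.exists_neighborSet_eq v
  have key : ∀ a b c, a ≠ b → a ≠ c → b ≠ c → G.neighborSet v = {a, b, c} → G.Adj a b →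
      ∃! T : G.Subgraph, T.IsTriangle ∧ v ∈ T.verts := by
    intro a b c hne hac hbc hN hab
    have hva : G.Adj v a := by
      rw [← mem_neighborSet, hN]
      simp
    have hvb : G.Adj v b := by
      rw [← mem_neighborSet, hN]
      simp
    have hvc : G.Adj v c := by
      rw [← mem_neighborSet, hN]
      simp
    have nac : ¬ G.Adj a c := fun h => h3.false_of_diamond hreg hcard hva hvb hvc hab h hbc
    have nbc : ¬ G.Adj b c := fun h => h3.false_of_diamond hreg hcard hvb hva hvc hab.symm h hac
    have huniq : ∀ x y, G.Adj v x → G.Adj v y → G.Adj x y → ({v, x, y} : Set V) = {v, a, b} := by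
      intro x y hx hy hxy
      rw [← mem_neighborSet, hN] at hx hy
      rcases hx with rfl | rfl | rfl <;> rcases hy with rfl | rfl | rfl <;>
        first
        | rfl
        | exact absurd rfl hxy.ne
        | exact absurd hxy nac
        | exact absurd hxy nbc
        | exact absurd hxy.symm nac
        | exact absurd hxy.symm nbc
        | exact congrArg (insert v) (Set.pair_comm _ _)
    obtain ⟨T, hT, hTv⟩ := exists_isTriangle_of_adj hva hvb hab
    refine ⟨T, ⟨hT, by simp [hTv]⟩, ?_⟩
    rintro T' ⟨hT', hv⟩
    refine hT'.eq_of_verts_eq hT ?_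
    obtain ⟨x, y, z, hxy, hxz, hyz, hverts⟩ := hT'.exists_verts_eq
    rw [hTv, hverts]
    rw [hverts] at hv
    rcases hv with rfl | rfl | rfl
    · exact huniq y z hxy.adj_sub hxz.adj_sub hyz.adj_sub
    · rw [← huniq x z hxy.adj_sub.symm hyz.adj_sub hxz.adj_sub, Set.insert_comm]
    · rw [← huniq x y hxz.adj_sub.symm hyz.adj_sub.symm hxy.adj_sub, Set.insert_comm v,
        Set.pair_comm v]
  have hmem : ∀ w ∈ ({a, b, c} : Set V), G.Adj v w := by
    rw [← hN]
    exact fun w hw => hw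
  rcases hG.exists_adj (hmem a (by simp)) (hmem b (by simp)) (hmem c (by simp)) hab hac hbc with
    h1 | h1 | h1
  · exact key a b c hab hac hbc hN h1
  · exact key a c b hac hab hbc.symm (by rw [hN, Set.pair_comm]) h1
  · exact key b c a hbc hab.symm hac.symm (by rw [hN, Set.insert_comm, Set.pair_comm a]) h1

/-- In a 3-connected graph, deleting edges that are all incident to `u` or `z` keeps any two other
vertices connected. -/
theorem IsKConnected.reachable_deleteEdges [Fintype V] (h3 : G.IsKConnected 3) {u z v w : V}
    {E : Set (Sym2 V)} (hE : ∀ e ∈ E, u ∈ e ∨ z ∈ e) (hvu : v ≠ u) (hvz : v ≠ z) (hwu : w ≠ u)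
    (hwz : w ≠ z) : (G.deleteEdges E).Reachable v w := by
  classical
  by_contra hcon
  obtain ⟨a, b, hab, ha, hb, haS, hbS⟩ := h3.exists_crossing (S := {u, z})
    ((Finset.card_le_two).trans_lt (by norm_num)) (U := {w | (G.deleteEdges E).Reachable v w})
    (a := v) (b := w) (Reachable.refl v) (by simp [hvu, hvz]) hcon (by simp [hwu, hwz])
  simp only [Finset.mem_insert, Finset.mem_singleton, not_or] at haS hbS
  refine hb (Reachable.trans ha (Adj.reachable ?_))
  rw [deleteEdges_adj]
  refine ⟨hab, fun h1 => ?_⟩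
  rcases hE _ h1 with h1 | h1 <;> rcases Sym2.mem_iff.1 h1 with h1 | h1
  · exact haS.1 h1.symm
  · exact hbS.1 h1.symm
  · exact haS.2 h1.symm
  · exact hbS.2 h1.symm

namespace TriangleStructure

variable {Q : Type*} {q : V → Q} {m : V → V}

/-- All deleted edges meet `a` or `z`, so the other vertices remain mutually reachable. Moreover `a`
keeps a triangle neighbour other than `b`, and `z` keeps `m z`. -/
theorem not_configE3 [Fintype V] (h : G.TriangleStructure q m) (h3 : G.IsKConnected 3)
    {E : Set (Sym2 V)} (hcard : E.ncard = 3) : ¬ G.ConfigE3 E := by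
  rintro ⟨H₂, H₁, hcomp, ⟨T, hT, hle⟩, -, hconn⟩
  obtain ⟨x, y, z, a, b, hxy, hxz, hyz, hverts, -, -, -, hab, -, haT, hbT, hEeq⟩ :=
    hcomp.exists_eq hcard hT hle
  rw [hverts] at haT hbT
  simp only [Set.mem_insert_iff, Set.mem_singleton_iff, not_or] at haT hbT
  have hadj_iff : ∀ v w, (G.deleteEdges E).Adj v w ↔ G.Adj v w ∧ s(v, w) ∉ E :=
    fun v w => deleteEdges_adj
  have hreach : ∀ v w, v ≠ a → v ≠ z → w ≠ a → w ≠ z → (G.deleteEdges E).Reachable v w := by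
    intro v w hva hvz hwa hwz
    refine h3.reachable_deleteEdges (u := a) (z := z) ?_ hva hvz hwa hwz
    rw [hEeq]
    rintro e (rfl | rfl | rfl) <;> simp
  have hx : q x = q z := h.q_eq_of_isTriangle hT (T.edge_vert hxz) (T.edge_vert hxz.symm)
  have hy : q y = q z := h.q_eq_of_isTriangle hT (T.edge_vert hyz) (T.edge_vert hyz.symm)
  have haq : q a ≠ q z := fun e =>
    absurd (h.eq_of_class hxy.ne hxz.ne hyz.ne hx hy e) (by tauto)
  have hax : (G.deleteEdges E).Reachable a x := by
    obtain ⟨c, hca, hcb, hc⟩ := h.exists_third b a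
    have hcz : c ≠ z := fun e => haq (by rw [← hc, e])
    have : (G.deleteEdges E).Adj a c := by
      refine (hadj_iff _ _).2 ⟨h.adj_of_q hcb.symm hc.symm, ?_⟩
      rw [hEeq]
      rintro (h1 | h1 | h1) <;> rcases Sym2.eq_iff.1 h1 with ⟨h1, h2⟩ | ⟨h1, h2⟩ <;> tauto
    exact this.reachable.trans (hreach c x hcb hcz (fun e => haT.1 e.symm) hxz.ne)
  have hzx : (G.deleteEdges E).Reachable z x := by
    have hzm : (G.deleteEdges E).Adj z (m z) := by
      refine (hadj_iff _ _).2 ⟨h.adj_m z, ?_⟩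
      rw [hEeq]
      have h4 : z ≠ m z := (h.m_ne z).symm
      have h5 : m z ≠ x := fun e => h.ne z (by rw [e, hx])
      have h6 : m z ≠ y := fun e => h.ne z (by rw [e, hy])
      rintro (h1 | h1 | h1) <;> rcases Sym2.eq_iff.1 h1 with ⟨h1, h2⟩ | ⟨h1, h2⟩ <;> tauto
    -- If `m z` is itself the exceptional vertex `a`, the connection continues through the neighbour
    -- kept by `a`.
    by_cases hma : m z = a
    · rw [hma] at hzm
      exact hzm.reachable.trans hax
    · exact hzm.reachable.trans (hreach _ x hma (h.m_ne z) (fun e => haT.1 e.symm) hxz.ne)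
  have hall : ∀ v, (G.deleteEdges E).Reachable v x := by
    intro v
    by_cases hva : v = a
    · exact hva ▸ hax
    · by_cases hvz : v = z
      · exact hvz ▸ hzx
      · exact hreach v x hva hvz (fun e => haT.1 e.symm) hxz.ne
  have : Nonempty V := ⟨z⟩
  exact hconn ⟨fun v w => (hall v).trans (hall w).symm⟩

end TriangleStructure

/-- The edges `d` and `t` meet `c` or `t₁`, so `a` still reaches every vertex other than these two.
Both `x` and `y` would then have to equal `c`. -/
theorem not_configE4 [Fintype V] (h3 : G.IsKConnected 3)
    {E : Set (Sym2 V)} (hcard : E.ncard = 3) : ¬ G.ConfigE4 E := by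
  rintro ⟨H₂, H₁, T, D, hcomp, hT, hle, hD, hleD, c, t₁, d, t, ⟨hcD, hcH₁⟩, ⟨htT, htiso⟩,
    ⟨-, hcd⟩, ⟨-, ht₁t⟩, C₁, C₂, hne, hC₁, hC₂⟩
  obtain ⟨x, y, z, a, b, hxy, hxz, hyz, hverts, hHxz, hHyz, hH₂, hab, hH₁, haT, hbT, -⟩ :=
    hcomp.exists_eq hcard hT hle
  have htz : t₁ = z := by
    have hxyH : s(x, y) ∉ H₂.edgeSet := by
      rw [hH₂]
      simp [hxz.ne, hyz.ne, hxy.ne]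
    rw [hverts] at htT
    rcases htT with rfl | rfl | rfl
    · exact absurd ((Subgraph.deleteEdges_adj _ _ _).2 ⟨hxy, hxyH⟩) (htiso y)
    · exact absurd ((Subgraph.deleteEdges_adj _ _ _).2 ⟨hxy.symm, Sym2.eq_swap ▸ hxyH⟩) (htiso x)
    · rfl
  subst htz
  have haH := H₁.edge_vert hab
  have hbH := H₁.edge_vert hab.symm
  have hac : a ≠ c := fun e => hcH₁ (e ▸ haH)
  have hat : a ≠ t₁ := fun e => haT (e ▸ htT)
  have h4 := hC₁ haH
  rw [ConnectedComponent.mem_supp_iff] at h4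
  have hE : ∀ e ∈ ({d, t} : Set (Sym2 V)), c ∈ e ∨ t₁ ∈ e := by
    rintro e (rfl | rfl)
    · exact Or.inl hcd
    · exact Or.inr ht₁t
  have key : ∀ x ∈ H₂.verts, x ≠ t₁ → x = c := by
    intro x hx hxt
    by_contra hxc
    have h5 := hC₂ hx
    rw [ConnectedComponent.mem_supp_iff] at h5
    refine hne ?_
    rw [← h4, ← h5, ConnectedComponent.eq]
    exact h3.reachable_deleteEdges hE hac hat hxc hxt
  exact hxy.ne ((key x (H₂.edge_vert hHxz) hxz.ne).trans (key y (H₂.edge_vert hHyz) hyz.ne).symm)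

end SimpleGraph

theorem mainTheorem7 {V : Type*} [Fintype V] (G : SimpleGraph V) [G.LocallyFinite] :
    -- three edges in a 2-connected Δ-graph
    (G.IsKConnected 2 → G.IsDeltaGraph →
      ∀ E : Set (Sym2 V), E ⊆ G.edgeSet → E.ncard = 3 →
        (¬ (G.deleteEdges E).HasLambdaFactor ↔
          ((G.edgeInduced E).IsClaw ∨ (G.edgeInduced E).IsTriangle ∨
            G.ConfigE3 E ∨ G.ConfigE4 E))) ∧
    -- two edges in a 2-connected Δ-graph
    (G.IsKConnected 2 → G.IsDeltaGraph →
      ∀ E : Set (Sym2 V), E ⊆ G.edgeSet → E.ncard = 2 →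
        (G.deleteEdges E).HasLambdaFactor) ∧
    -- three edges in a 3-connected cubic claw-free graph
    (G.IsKConnected 3 → G.IsRegularOfDegree 3 → G.IsClawFree → 6 ≤ Fintype.card V →
      ∀ E : Set (Sym2 V), E ⊆ G.edgeSet → E.ncard = 3 →
        ((G.deleteEdges E).HasLambdaFactor ↔
          (¬ (G.edgeInduced E).IsClaw ∧ ¬ (G.edgeInduced E).IsTriangle))) := by
  have key : G.IsKConnected 2 → G.IsDeltaGraph →
      ∀ E : Set (Sym2 V), E ⊆ G.edgeSet → E.ncard = 3 →
        (¬ (G.deleteEdges E).HasLambdaFactor ↔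
          ((G.edgeInduced E).IsClaw ∨ (G.edgeInduced E).IsTriangle ∨
            G.ConfigE3 E ∨ G.ConfigE4 E)) := by
    intro h2 hG E hEG hcard
    obtain ⟨q, m, h⟩ := hG.exists_triangleStructure
    constructor
    · exact h.config_of_not_hasLambdaFactor h2 hEG hcard
    · rintro (h1 | h1 | h1 | h1)
      · exact h.not_hasLambdaFactor_of_isClaw h1
      · exact h.not_hasLambdaFactor_of_edgeInduced_isTriangle h1
      · exact h.not_hasLambdaFactor_of_configE3 h2 hcard h1
      · exact h.not_hasLambdaFactor_of_configE4 h2 hcard h1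
  refine ⟨key, ?_, ?_⟩
  · intro h2 hG E _ hcard
    obtain ⟨q, m, h⟩ := hG.exists_triangleStructure
    exact h.hasLambdaFactor_of_ncard_eq_two h2 hcard
  · intro h3 hreg hclaw hV E hEG hcard
    have hG := hclaw.isDeltaGraph h3 hreg hV
    obtain ⟨q, m, h⟩ := hG.exists_triangleStructure
    have hiff := key (h3.mono (by norm_num)) hG E hEG hcard
    have hE3 := h.not_configE3 h3 hcard
    have hE4 := SimpleGraph.not_configE4 h3 hcard
    tauto
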